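/- **Conventions.** Let $\mathcal A,\mathcal B$ be unital associative real algebras with involution $*$ (additive, $(xy)^*=y^*x^*$, $x^{**}=x$, $(\lambda x)^*=\lambda x^*$ for $\lambda\in\mathbb R$). A *special JB algebra* in $\mathcal A$ is a finite-dimensional real subspace $A\subseteq\{a\in\mathcal A: a^*=a\}$ that contains $1$, is closed under $a\circ b=\tfrac12(ab+ba)$, and carries a (complete) norm with $\|a\circ b\|\le\|a\|\|b\|$, $\|a^2\|=\|a\|^2$ and $\|a^2\|\le\|a^2+b^2\|$ for all $a,b\in A$. It is *simple* if it is nonzero and its only Jordan ideals are $0$ and $A$. It is a *spin factor* if $A=\mathbb R1\oplus V$ with $v\circ w\in\mathbb R1$ for all $v,w\in V$. $\mathcal A$ is an *enveloping algebra* of $A$ if it is generated by $A$ as a real algebra. Let $A\subseteq\mathcal A$ and $B\subseteq\mathcal B$ be special JB algebras. A map $\gamma:A\to B$ is an *encoding* if $\mathrm{spec}(\gamma(a))=\mathrm{spec}(a)$ (real spectra, in $\mathcal B$ and $\mathcal A$) and $\gamma(\lambda a_1+(1-\lambda)a_2)=\lambda\gamma(a_1)+(1-\lambda)\gamma(a_2)$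 for all $a,a_1,a_2\in A$ and $\lambda\in[0,1]$. An *extended encoding* is a map $\Gamma:\mathcal A\to\mathcal B$ with $\Gamma|_A=\gamma$ that is additive and multiplicative. **Lemma (Extended simulation for simple algebras).** Let $\gamma:A\to B$ be an encoding, where $A$ is simple and $\mathcal A$ is an enveloping algebra of $A$. Then $\gamma$ is $\mathbb R$-linear. There is at most one extended encoding $\Gamma:\mathcal A\to\mathcal B$ of $\gamma$, and it satisfies, for all $\alpha_1,\alpha_2,\alpha\in\mathcal A$ and $\lambda\in\mathbb R$: 1. $\Gamma(\alpha_1+\alpha_2)=\Gamma(\alpha_1)+\Gamma(\alpha_2)$; 2. $\Gamma(\alpha_1\alpha_2)=\Gamma(\alpha_1)\Gamma(\alpha_2)$; 3. $\Gamma(1_{\mathcal A})=1_{\mathcal B}$; 4. $\Gamma(\lambda\alpha)=\lambda\Gamma(\alpha)$; 5. $\Gamma(\alpha^*)=\Gamma(\alpha)^*$. The extended encoding exists, unless $A$ is a spin factor with $\dim_{\mathbb R}A\equiv 2\pmod 4$ and $\mathcal A$ is a simple ring; in that exceptional case existence is not asserted. (In particular it exists for $A=\mathrm{Herm}_n(\mathbb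 C)$, $\mathcal A=M_n(\mathbb C)$, $n\ge2$.) -/

import Mathlib

namespace Encodings

section

variable {R : Type*} [Ring R] [Algebra ℝ R]

/-- The Jordan product `a ∘ b = (ab + ba) / 2` of an associative real algebra. -/
noncomputable def jordanProd (a b : R) : R := (1 / 2 : ℝ) • (a * b + b * a)

/-- `A` is a (unital) finite-dimensional special JB algebra, realised by symmetric elements of the
associative algebra `R` with involution `star`: a finite-dimensional real subspace of symmetric
elements, containing `1`, closed under the Jordan product, which carries a norm with
`‖a ∘ b‖ ≤ ‖a‖ ‖b‖`, `‖a²‖ = ‖a‖²` and `‖a²‖ ≤ ‖a² + b²‖`.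
Completeness of the norm is automatic, since `A` is finite-dimensional; note that
`a² = a ∘ a`. -/
structure IsSpecialJB [StarRing R] (A : Submodule ℝ R) : Prop where
  star_eq : ∀ a ∈ A, star a = a
  one_mem : (1 : R) ∈ A
  jordan_mem : ∀ a ∈ A, ∀ b ∈ A, jordanProd a b ∈ A
  finiteDimensional : FiniteDimensional ℝ A
  exists_norm : ∃ N : Seminorm ℝ A,
    (∀ a : A, N a = 0 → a = 0) ∧
    (∀ a b : A, N ⟨jordanProd a b, jordan_mem a a.2 b b.2⟩ ≤ N a * N b) ∧
    (∀ a : A, N ⟨jordanProd a a, jordan_mem a a.2 a a.2⟩ = N a ^ 2) ∧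
    (∀ a b : A, N ⟨jordanProd a a, jordan_mem a a.2 a a.2⟩ ≤
      N (⟨jordanProd a a, jordan_mem a a.2 a a.2⟩ + ⟨jordanProd b b, jordan_mem b b.2 b b.2⟩))

/-- The Jordan algebra `A` is simple: it is nonzero, and `0` and `A` are its only Jordan ideals. -/
def IsSimpleJordan (A : Submodule ℝ R) : Prop :=
  A ≠ ⊥ ∧ ∀ I : Submodule ℝ R, I ≤ A → (∀ a ∈ A, ∀ x ∈ I, jordanProd a x ∈ I) → I = ⊥ ∨ I = A

/-- The Jordan algebra `A` is a spin factor: `A = ℝ1 ⊕ V`, and the Jordan product of any two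
elements of `V` is a real multiple of `1` (for JB algebras the resulting bilinear form on `V` is
automatically positive definite). -/
def IsSpinFactor (A : Submodule ℝ R) : Prop :=
  ∃ V : Submodule ℝ R, Disjoint (Submodule.span ℝ {(1 : R)}) V ∧
    Submodule.span ℝ {(1 : R)} ⊔ V = A ∧
    ∀ v ∈ V, ∀ w ∈ V, ∃ r : ℝ, jordanProd v w = r • (1 : R)

/-- A map `γ : A → B` is an encoding if it preserves spectra and is convex. The elements of `A`
and `B` are observables, all of whose spectral values are real; the spectrum is the one in the
ambient associative algebra. -/
structure IsEncoding {S : Type*} [Ring S] [Algebra ℝ S]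
    {A : Submodule ℝ R} {B : Submodule ℝ S} (γ : A → B) : Prop where
  spectrum_eq : ∀ a : A, spectrum ℝ (γ a : S) = spectrum ℝ (a : R)
  convex : ∀ a₁ a₂ : A, ∀ t ∈ Set.Icc (0 : ℝ) 1,
    γ (t • a₁ + (1 - t) • a₂) = t • γ a₁ + (1 - t) • γ a₂

/-- `Γ : R → S` is an associative extension of `γ : A → B`: it agrees with `γ` on `A`, and it is
additive and multiplicative. -/
structure IsExtendedEncoding {S : Type*} [Ring S] [Algebra ℝ S]
    {A : Submodule ℝ R} {B : Submodule ℝ S} (γ : A → B) (Γ : R → S) : Prop where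
  extends_map : ∀ a : A, Γ (a : R) = (γ a : S)
  map_add : ∀ α₁ α₂ : R, Γ (α₁ + α₂) = Γ α₁ + Γ α₂
  map_mul : ∀ α₁ α₂ : R, Γ (α₁ * α₂) = Γ α₁ * Γ α₂

end

end Encodings

/-! The norm axioms make a special JB algebra formally real, so each element has a minimal
polynomial with simple real roots, all of them spectral values. Spectral conditions therefore become
polynomial identities: `γ` sends 0 to 0 and 1 to 1, is linear by convexity, and maps idempotents to
idempotents. Applied to sums of orthogonal idempotents and to spectral decompositions, this gives
`γ(a²) = γ(a)²`, so `γ` is a Jordan homomorphism (`map_sq_of_spectrum_eq`,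
`map_mul_add_mul_of_map_sq`). Uniqueness and the listed properties of an extension follow because
`A` generates `𝒜`.

For existence, let `D ⊆ 𝒜 × ℬ` be the algebra generated by the graph of `γ`. An extension is the
second projection composed with the inverse of the first projection `π : D → 𝒜`, so the point is
that `π` is injective (`injective_of_enveloping`). Now `D` is itself an enveloping algebra of a copy
of the simple algebra `A`, and the nonzero ideals of such an algebra are controlled by the size of a
frame of minimal idempotents.

With three or more idempotents, simplicity connects them by matrix units. All matrix entries of
elements of the enveloping algebra then lie in one space whose nonzero elements are right invertible
in a corner, so every nonzero ideal contains 1 (`IsMatrixUnits.one_mem_of_ne_zero`) and `ker π = 0`.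

With one or two idempotents, `A` is spanned by 1 and `k` anticommuting square roots of 1. A nonzero
ideal then contains some `c + dω ≠ 0`, where `ω` is the product of the generators and `d = 0` for
even `k` (`exists_mem_span_one_mon`). Such an element of `ker π` would make `ω` a scalar in `𝒜` with
`k` odd. For `k ≡ 3 mod 4` this contradicts `ω² = -1`; for `k ≡ 1 mod 4` it forces `𝒜` to be simple,
which is the excluded case since `dim A = k + 1`. -/

namespace Encodings

/-! ### Formally real Jordan algebras and their spectral calculus. -/

open Polynomial

/-- A unital, finite-dimensional and formally real Jordan subalgebra of an associative algebra. -/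
structure IsFormallyReal {R : Type*} [Ring R] [Algebra ℝ R] (A : Submodule ℝ R) : Prop where
  one_mem : (1 : R) ∈ A
  mul_add_mul_mem : ∀ {a b : R}, a ∈ A → b ∈ A → a * b + b * a ∈ A
  finiteDimensional : FiniteDimensional ℝ A
  eq_zero_of_sq_add_sq : ∀ {a b : R}, a ∈ A → b ∈ A → a * a + b * b = 0 → a = 0

theorem mem_of_two_smul_mem {R : Type*} [Ring R] [Algebra ℝ R] {A : Submodule ℝ R} {x : R}
    (h : (2 : ℝ) • x ∈ A) : x ∈ A := by
  have := A.smul_mem (1 / 2) h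
  rwa [smul_smul, one_div_mul_cancel two_ne_zero, one_smul] at this

theorem jordanProd_self {R : Type*} [Ring R] [Algebra ℝ R] (a : R) : jordanProd a a = a * a := by
  rw [jordanProd, ← two_smul ℝ (a * a), smul_smul]; norm_num

/-- If `a² + b² = 0`, then `‖a‖² = ‖a²‖ ≤ ‖a² + b²‖ = 0`. Everything later uses the norm only
through this consequence. -/
theorem IsSpecialJB.isFormallyReal {R : Type*} [Ring R] [Algebra ℝ R] [StarRing R]
    {A : Submodule ℝ R} (hA : IsSpecialJB A) : IsFormallyReal A where
  one_mem := hA.one_mem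
  mul_add_mul_mem {a b} ha hb := by
    have h := A.smul_mem 2 (hA.jordan_mem a ha b hb)
    rw [jordanProd, smul_smul] at h
    norm_num at h
    exact h
  finiteDimensional := hA.finiteDimensional
  eq_zero_of_sq_add_sq {a b} ha hb h := by
    obtain ⟨N, hN0, -, hNsq, hNadd⟩ := hA.exists_norm
    have h1 := hNadd ⟨a, ha⟩ ⟨b, hb⟩
    have h2 : (⟨jordanProd a a, hA.jordan_mem a ha a ha⟩ +
        ⟨jordanProd b b, hA.jordan_mem b hb b hb⟩ : A) = 0 := by
      ext
      simpa [jordanProd_self] using h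
    rw [h2, hNsq, map_zero] at h1
    have h3 : N ⟨a, ha⟩ = 0 := by
      have := sq_nonneg (N ⟨a, ha⟩)
      exact pow_eq_zero_iff two_ne_zero |>.1 (le_antisymm h1 this)
    simpa using congrArg Subtype.val (hN0 _ h3)

namespace IsFormallyReal

variable {R : Type*} [Ring R] [Algebra ℝ R] {A : Submodule ℝ R} (hA : IsFormallyReal A)
include hA

theorem mul_mem_of_commute {a b : R} (ha : a ∈ A) (hb : b ∈ A) (h : Commute a b) : a * b ∈ A := by
  apply mem_of_two_smul_mem
  rw [two_smul]
  nth_rw 2 [h.eq]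
  exact hA.mul_add_mul_mem ha hb

theorem sq_mem {a : R} (ha : a ∈ A) : a * a ∈ A := hA.mul_mem_of_commute ha ha rfl

/-- Twice the triple product is a combination of iterated Jordan products: writing `{p,q} = pq +
qp`, it is `{{x,a},y} + {{a,y},x} - {{x,y},a}` divided by 1, that is `2(xay + yax)`. -/
theorem triple_mem {a x y : R} (ha : a ∈ A) (hx : x ∈ A) (hy : y ∈ A) :
    x * a * y + y * a * x ∈ A := by
  apply mem_of_two_smul_mem
  have h1 := hA.mul_add_mul_mem (hA.mul_add_mul_mem hx ha) hy
  have h2 := hA.mul_add_mul_mem (hA.mul_add_mul_mem ha hy) hx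
  have h3 := hA.mul_add_mul_mem (hA.mul_add_mul_mem hx hy) ha
  have := A.sub_mem (A.add_mem h1 h2) h3
  convert this using 1
  rw [two_smul]
  noncomm_ring

theorem conj_mem {a x : R} (ha : a ∈ A) (hx : x ∈ A) : x * a * x ∈ A := by
  apply mem_of_two_smul_mem
  rw [two_smul]
  exact hA.triple_mem ha hx hx

theorem pow_mem {a : R} (ha : a ∈ A) (n : ℕ) : a ^ n ∈ A := by
  induction n with
  | zero => simpa using hA.one_mem
  | succ n ih =>
    rw [pow_succ]
    exact hA.mul_mem_of_commute ih ha (Commute.pow_self a n)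

theorem aeval_mem {a : R} (ha : a ∈ A) (p : ℝ[X]) : aeval a p ∈ A := by
  rw [aeval_eq_sum_range]
  exact A.sum_mem fun i _ => A.smul_mem _ (hA.pow_mem ha i)

theorem eq_zero_of_sq {a : R} (ha : a ∈ A) (h : a * a = 0) : a = 0 :=
  hA.eq_zero_of_sq_add_sq ha A.zero_mem (by simpa using h)

theorem isIntegral {a : R} (ha : a ∈ A) : IsIntegral ℝ a := by
  have := hA.finiteDimensional
  have hle : Subalgebra.toSubmodule (Algebra.adjoin ℝ {a}) ≤ A := by
    intro x hx
    rw [Subalgebra.mem_toSubmodule, Algebra.adjoin_singleton_eq_range_aeval] at hx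
    obtain ⟨p, rfl⟩ := hx
    exact hA.aeval_mem ha p
  have : FiniteDimensional ℝ (Algebra.adjoin ℝ {a}) :=
    Submodule.finiteDimensional_of_le hle
  exact .of_mem_of_fg _ (Module.Finite.iff_fg.1 this) _ (Algebra.self_mem_adjoin_singleton ℝ a)

theorem aeval_ne_zero_of_minpoly_eq_mul {a : R} (ha : a ∈ A) {q g : ℝ[X]}
    (h : minpoly ℝ a = q * g) (hq : 0 < q.natDegree) : aeval a g ≠ 0 := by
  intro h0
  have hm := minpoly.ne_zero (hA.isIntegral ha)
  have hg : g ≠ 0 := by rintro rfl; simp [h] at hm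
  have hq' : q ≠ 0 := by rintro rfl; simp at hq
  have h1 := natDegree_le_of_dvd (minpoly.dvd ℝ a h0) hg
  rw [h, natDegree_mul hq' hg] at h1
  omega

/-- A nonreal root `s + it` gives a factor `(X - s)² + t²` with cofactor `g`. Then `(t g(a))² + ((a
- s) g(a))² = 0`, so formal reality yields `g(a) = 0`, against minimality. -/
theorem splits_minpoly {a : R} (ha : a ∈ A) : (minpoly ℝ a).Splits := by
  refine Splits.of_splits_map_of_injective (i := algebraMap ℝ ℂ)
    (algebraMap ℝ ℂ).injective (IsAlgClosed.splits _) ?_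
  intro z hz
  have hz0 : aeval z (minpoly ℝ a) = 0 := by
    rw [mem_roots', IsRoot, eval_map_algebraMap] at hz
    exact hz.2
  by_cases him : z.im = 0
  · exact ⟨z.re, by apply Complex.ext <;> simp [him]⟩
  · exfalso
    obtain ⟨g, hg⟩ := quadratic_dvd_of_aeval_eq_zero_im_ne_zero _ hz0 him
    refine hA.aeval_ne_zero_of_minpoly_eq_mul ha hg ?_ ?_
    · have : (X ^ 2 - C (2 * z.re) * X + C (‖z‖ ^ 2) : ℝ[X]).natDegree = 2 := by compute_degree!
      omega
    · have key : aeval a ((C z.im * g) * (C z.im * g) +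
          ((X - C z.re) * g) * ((X - C z.re) * g)) = 0 := by
        have : (C z.im * g) * (C z.im * g) + ((X - C z.re) * g) * ((X - C z.re) * g) =
            minpoly ℝ a * g := by
          rw [hg, Complex.sq_norm, Complex.normSq_apply]
          simp only [map_mul, map_add, map_ofNat]
          ring
        rw [this, map_mul, minpoly.aeval, zero_mul]
      rw [map_add, map_mul, map_mul (aeval a) ((X - C z.re) * g)] at key
      have h0 := hA.eq_zero_of_sq_add_sq (hA.aeval_mem ha _) (hA.aeval_mem ha _) key
      rw [map_mul, aeval_C, ← Algebra.smul_def] at h0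
      exact (smul_eq_zero.1 h0).resolve_left him

/-- A double root would produce a nonzero element of square zero. -/
theorem nodup_roots_minpoly {a : R} (ha : a ∈ A) : (minpoly ℝ a).roots.Nodup := by
  have hm := minpoly.ne_zero (hA.isIntegral ha)
  rw [Multiset.nodup_iff_count_le_one]
  intro r
  by_contra! hr
  rw [count_roots] at hr
  obtain ⟨g, hg⟩ := (le_rootMultiplicity_iff hm (n := 2)).1 hr
  have hg' : minpoly ℝ a = (X - C r) * ((X - C r) * g) := by rw [hg]; ring
  refine hA.aeval_ne_zero_of_minpoly_eq_mul ha hg' (by simp) ?_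
  apply hA.eq_zero_of_sq (hA.aeval_mem ha _)
  rw [← map_mul, show (X - C r) * g * ((X - C r) * g) = minpoly ℝ a * g by rw [hg]; ring,
    map_mul, minpoly.aeval, zero_mul]

theorem mem_spectrum_of_isRoot {a : R} (ha : a ∈ A) {r : ℝ} (hr : (minpoly ℝ a).IsRoot r) :
    r ∈ spectrum ℝ a := by
  obtain ⟨g, hg⟩ := dvd_iff_isRoot.2 hr
  intro hu
  refine hA.aeval_ne_zero_of_minpoly_eq_mul ha hg (by simp) ?_
  have h0 : (algebraMap ℝ R r - a) * aeval a g = 0 := by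
    have : aeval a ((X - C r) * g) = 0 := by rw [← hg, minpoly.aeval]
    rw [map_mul, map_sub, aeval_X, aeval_C] at this
    rw [← neg_sub, neg_mul, this, neg_zero]
  exact (hu.mul_right_eq_zero).1 h0

/-- The minimal polynomial splits with simple roots, all in the spectrum, hence divides `f`. This is
how spectral hypotheses become algebraic identities. -/
theorem aeval_eq_zero_of_spectrum {a : R} (ha : a ∈ A) {f : ℝ[X]}
    (hf : ∀ r ∈ spectrum ℝ a, f.eval r = 0) : aeval a f = 0 := by
  rcases eq_or_ne f 0 with rfl | hf0
  · simp
  refine aeval_eq_zero_of_dvd_aeval_eq_zero ?_ (minpoly.aeval ℝ a)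
  refine (hA.splits_minpoly ha).dvd_of_roots_le_roots (minpoly.ne_zero (hA.isIntegral ha)) ?_
  rw [Multiset.le_iff_subset (hA.nodup_roots_minpoly ha)]
  intro r hr
  rw [mem_roots hf0]
  exact hf r (hA.mem_spectrum_of_isRoot ha (isRoot_of_mem_roots hr))

theorem spectrum_finite {a : R} (ha : a ∈ A) : (spectrum ℝ a).Finite := by
  have hm := minpoly.ne_zero (hA.isIntegral ha)
  rcases subsingleton_or_nontrivial R with hR | hR
  · rw [spectrum.of_subsingleton]; exact Set.finite_empty
  refine (minpoly ℝ a).roots.toFinset.finite_toSet.subset fun r hr => ?_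
  have := spectrum.subset_polynomial_aeval a (minpoly ℝ a) ⟨r, hr, rfl⟩
  rw [minpoly.aeval, spectrum.zero_eq] at this
  simpa [hm] using this

/-- Spectral decomposition into orthogonal idempotents. -/
theorem exists_spectral_idempotents {a : R} (ha : a ∈ A) :
    ∃ (s : Finset ℝ) (p : ℝ → R), (∀ r, p r ∈ A) ∧ (∀ r c, Commute c a → Commute c (p r)) ∧
      (∀ r ∈ s, p r * p r = p r) ∧ (∀ r ∈ s, ∀ t ∈ s, r ≠ t → p r * p t = 0) ∧
      ∑ r ∈ s, r • p r = a := by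
  classical
  set s := (hA.spectrum_finite ha).toFinset with hs
  -- Polynomials agreeing on the spectrum agree at `a`; the idempotents will be the Lagrange basis
  -- polynomials at the spectral points.
  have hz : ∀ {f g : ℝ[X]}, (∀ r ∈ s, f.eval r = g.eval r) → aeval a f = aeval a g := by
    intro f g h
    rw [← sub_eq_zero, ← map_sub]
    apply hA.aeval_eq_zero_of_spectrum ha
    intro r hr
    rw [eval_sub, h r (by simpa [hs] using hr), sub_self]
  have hin : Set.InjOn (id : ℝ → ℝ) s := Function.injective_id.injOn
  have hev : ∀ r ∈ s, ∀ t ∈ s, (Lagrange.basis s id r).eval t = if r = t then 1 else 0 := by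
    intro r hr t ht
    split_ifs with h
    · subst h; exact Lagrange.eval_basis_self (v := (id : ℝ → ℝ)) hin hr
    · exact Lagrange.eval_basis_of_ne (v := (id : ℝ → ℝ)) h ht
  refine ⟨s, fun r => aeval a (Lagrange.basis s id r), fun r => hA.aeval_mem ha _,
    fun r c hc => ?_, fun r hr => ?_, fun r hr t ht hrt => ?_, ?_⟩
  · dsimp only
    rw [aeval_eq_sum_range]
    exact Commute.sum_right _ _ _ fun i _ => (hc.pow_right i).smul_right _
  · rw [← map_mul]
    apply hz
    intro t ht
    rw [eval_mul, hev r hr t ht]; split_ifs <;> simp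
  · rw [← map_mul, ← map_zero (aeval (R := ℝ) a)]
    apply hz
    intro u hu
    rw [eval_mul, hev r hr u hu, hev t ht u hu]
    split_ifs with h1 h2 <;> simp_all
  · simp_rw [← map_smul]
    rw [← map_sum]
    nth_rw 2 [← aeval_X (R := ℝ) a]
    apply hz
    intro u hu
    rw [eval_finsetSum, Finset.sum_congr rfl fun r hr => by rw [eval_smul, hev r hr u hu]]
    simp [hu]

theorem isIdempotentElem_of_spectrum {a : R} (ha : a ∈ A) (h : spectrum ℝ a ⊆ {0, 1}) :
    IsIdempotentElem a := by
  have := hA.aeval_eq_zero_of_spectrum ha (f := X * X - X) (fun r hr => by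
    rcases h hr with rfl | rfl <;> simp)
  rwa [map_sub, map_mul, aeval_X, sub_eq_zero] at this

theorem eq_algebraMap_of_spectrum {a : R} (ha : a ∈ A) {t : ℝ} (h : spectrum ℝ a ⊆ {t}) :
    a = algebraMap ℝ R t := by
  have := hA.aeval_eq_zero_of_spectrum ha (f := X - C t) (fun r hr => by
    rw [Set.mem_singleton_iff.1 (h hr)]; simp)
  simpa [sub_eq_zero] using this

end IsFormallyReal

end Encodings
-- Encodings are linear Jordan homomorphisms.
namespace Encodings

/-- Only the anticommutators of the `q r` are assumed to vanish, as this is all that is known of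
images of orthogonal idempotents; hence the square is doubled and symmetrised. -/
theorem sum_smul_mul_self {S : Type*} [Ring S] [Algebra ℝ S] (s : Finset ℝ) (q : ℝ → S)
    (hq : ∀ r ∈ s, q r * q r = q r)
    (hqq : ∀ r ∈ s, ∀ t ∈ s, r ≠ t → q r * q t + q t * q r = 0) :
    (∑ r ∈ s, r • q r) * (∑ r ∈ s, r • q r) = ∑ r ∈ s, (r * r) • q r := by
  have h : (2 : ℝ) • ((∑ r ∈ s, r • q r) * (∑ r ∈ s, r • q r)) =
      (2 : ℝ) • ∑ r ∈ s, (r * r) • q r := by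
    calc (2 : ℝ) • ((∑ r ∈ s, r • q r) * (∑ r ∈ s, r • q r))
        = ∑ r ∈ s, ∑ t ∈ s, (r * t) • (q r * q t + q t * q r) := by
          rw [two_smul, Finset.sum_mul_sum]
          nth_rw 2 [Finset.sum_comm]
          rw [← Finset.sum_add_distrib]
          refine Finset.sum_congr rfl fun r _ => ?_
          rw [← Finset.sum_add_distrib]
          refine Finset.sum_congr rfl fun t _ => ?_
          rw [smul_mul_smul_comm, smul_mul_smul_comm, mul_comm t r, smul_add]
      _ = ∑ r ∈ s, (2 : ℝ) • (r * r) • q r := by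
          refine Finset.sum_congr rfl fun r hr => ?_
          rw [Finset.sum_eq_single_of_mem r hr fun t ht htr => by
            rw [hqq r hr t ht htr.symm, smul_zero], hq r hr, smul_comm, two_smul ℝ (q r)]
      _ = _ := by rw [Finset.smul_sum]
  exact smul_right_injective S (two_ne_zero (α := ℝ)) h

section

variable {R S : Type*} [Ring R] [Algebra ℝ R] [Ring S] [Algebra ℝ S]
  {A : Submodule ℝ R} {B : Submodule ℝ S}

theorem IsEncoding.map_zero [Nontrivial R] (hB : IsFormallyReal B) {γ : A → B}
    (hγ : IsEncoding γ) : γ 0 = 0 := by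
  ext
  rw [hB.eq_algebraMap_of_spectrum (γ 0).2 (t := 0) (by simp [hγ.spectrum_eq])]
  simp

theorem IsEncoding.map_one [Nontrivial R] (hA : IsFormallyReal A) (hB : IsFormallyReal B)
    {γ : A → B} (hγ : IsEncoding γ) : (γ ⟨1, hA.one_mem⟩ : S) = 1 := by
  rw [hB.eq_algebraMap_of_spectrum (γ _).2 (t := 1) (by simp [hγ.spectrum_eq])]
  simp

theorem IsEncoding.isLinearMap [Nontrivial R] (hB : IsFormallyReal B) {γ : A → B}
    (hγ : IsEncoding γ) : IsLinearMap ℝ γ := by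
  have hsm : ∀ t ∈ Set.Icc (0 : ℝ) 1, ∀ a, γ (t • a) = t • γ a := by
    intro t ht a
    simpa [hγ.map_zero hB] using hγ.convex a 0 t ht
  have hadd : ∀ a b, γ (a + b) = γ a + γ b := by
    intro a b
    have h1 := hγ.convex a b (1 / 2) (by norm_num)
    rw [show (1 - 1 / 2 : ℝ) = 1 / 2 by norm_num, ← smul_add, ← smul_add,
      hsm _ (by norm_num)] at h1
    exact smul_right_injective B (one_div_ne_zero (two_ne_zero (α := ℝ))) h1
  have hneg : ∀ a, γ (-a) = -γ a := by
    intro a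
    rw [eq_neg_iff_add_eq_zero, ← hadd, neg_add_cancel, hγ.map_zero hB]
  have hpos : ∀ t : ℝ, 0 ≤ t → ∀ a, γ (t • a) = t • γ a := by
    intro t ht a
    rcases le_total t 1 with h | h
    · exact hsm t ⟨ht, h⟩ a
    · have h0 : t ≠ 0 := by positivity
      have := hsm t⁻¹ ⟨by positivity, inv_le_one_of_one_le₀ h⟩ (t • a)
      rw [inv_smul_smul₀ h0] at this
      rw [this, smul_inv_smul₀ h0]
  refine ⟨hadd, fun t a => ?_⟩
  rcases le_total 0 t with h | h
  · exact hpos t h a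
  · have := hpos (-t) (by linarith) a
    rw [show t • a = -((-t) • a) by module, hneg, this]
    module

/-- Idempotents go to idempotents because their spectrum lies in `{0, 1}`. For orthogonal `p`, `q`
the image of `p + q` is idempotent too, so the images anticommute; squaring the image of a spectral
decomposition then leaves only diagonal terms. -/
theorem map_sq_of_spectrum_eq (hA : IsFormallyReal A) (hB : IsFormallyReal B) (f : A →ₗ[ℝ] S)
    (hfB : ∀ a, f a ∈ B) (hf : ∀ a : A, spectrum ℝ (f a) = spectrum ℝ (a : R)) (a : A) :
    f ⟨a * a, hA.sq_mem a.2⟩ = f a * f a := by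
  obtain ⟨s, p, hpA, -, hp, hpp, hsum⟩ := hA.exists_spectral_idempotents a.2
  have hidem : ∀ b : A, IsIdempotentElem (b : R) → IsIdempotentElem (f b) := by
    intro b hb
    apply hB.isIdempotentElem_of_spectrum (hfB b)
    rw [hf]
    exact hb.spectrum_subset ℝ
  set P : ℝ → A := fun r => ⟨p r, hpA r⟩
  have hq : ∀ r ∈ s, f (P r) * f (P r) = f (P r) := fun r hr => hidem _ (hp r hr)
  have hqq : ∀ r ∈ s, ∀ t ∈ s, r ≠ t → f (P r) * f (P t) + f (P t) * f (P r) = 0 := by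
    intro r hr t ht hrt
    have h1 : IsIdempotentElem (f (P r + P t)) := by
      apply hidem
      change (p r + p t) * (p r + p t) = p r + p t
      rw [add_mul, mul_add, mul_add, hp r hr, hp t ht, hpp r hr t ht hrt, hpp t ht r hr hrt.symm]
      simp
    have h2 : (f (P r) + f (P t)) * (f (P r) + f (P t)) = f (P r) + f (P t) := by
      simpa [IsIdempotentElem] using h1
    rw [add_mul, mul_add, mul_add, hq r hr, hq t ht] at h2
    have h3 : f (P r) * f (P t) + f (P t) * f (P r) =
      (f (P r) + f (P r) * f (P t) + (f (P t) * f (P r) + f (P t))) - (f (P r) + f (P t)) := by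
      abel
    rw [h3, h2, sub_self]
  have ha : a = ∑ r ∈ s, r • P r := by ext; simpa [P] using hsum.symm
  have haa : (⟨a * a, hA.sq_mem a.2⟩ : A) = ∑ r ∈ s, (r * r) • P r := by
    ext
    have := sum_smul_mul_self s p hp fun r hr t ht hrt => by
      rw [hpp r hr t ht hrt, hpp t ht r hr hrt.symm, add_zero]
    rw [hsum] at this
    simpa [P] using this
  rw [haa]
  nth_rw 1 2 [ha]
  simp_rw [map_sum, map_smul]
  exact (sum_smul_mul_self s (fun r => f (P r)) hq hqq).symm

theorem map_mul_add_mul_of_map_sq (hA : IsFormallyReal A) (f : A →ₗ[ℝ] S)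
    (hf : ∀ a : A, f ⟨a * a, hA.sq_mem a.2⟩ = f a * f a) (a b : A) :
    f ⟨a * b + b * a, hA.mul_add_mul_mem a.2 b.2⟩ = f a * f b + f b * f a := by
  have h : (⟨a * b + b * a, hA.mul_add_mul_mem a.2 b.2⟩ : A) =
      ⟨(a + b : A) * (a + b : A), hA.sq_mem (a + b).2⟩ - ⟨a * a, hA.sq_mem a.2⟩ -
        ⟨b * b, hA.sq_mem b.2⟩ := by
    ext
    simp only [Submodule.coe_add, AddSubgroupClass.coe_sub]
    noncomm_ring
  rw [h, map_sub, map_sub, hf, hf, hf, map_add]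
  noncomm_ring

/-! ### Uniqueness and properties of extended encodings. -/

namespace IsExtendedEncoding

variable {γ : A → B} {Γ Γ' : R → S}

theorem map_one (hA : (1 : R) ∈ A) (hγ : (γ ⟨1, hA⟩ : S) = 1) (h : IsExtendedEncoding γ Γ) :
    Γ 1 = 1 := by
  rw [← hγ, ← h.extends_map]

theorem map_smul (hA : (1 : R) ∈ A) (hγ1 : (γ ⟨1, hA⟩ : S) = 1) (hγ : IsLinearMap ℝ γ)
    (h : IsExtendedEncoding γ Γ) (r : ℝ) (α : R) : Γ (r • α) = r • Γ α := by
  have h1 : Γ (r • (1 : R)) = r • (1 : S) := by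
    have := h.extends_map (r • ⟨1, hA⟩)
    rw [hγ.map_smul] at this
    simpa [hγ1] using this
  rw [← smul_one_mul, h.map_mul, h1, smul_one_mul]

/-- An extended encoding as a homomorphism of algebras. -/
def toAlgHom (hA : (1 : R) ∈ A) (hγ1 : (γ ⟨1, hA⟩ : S) = 1) (hγ : IsLinearMap ℝ γ)
    (h : IsExtendedEncoding γ Γ) : R →ₐ[ℝ] S :=
  AlgHom.ofLinearMap
    { toFun := Γ
      map_add' := h.map_add
      map_smul' := h.map_smul hA hγ1 hγ }
    (h.map_one hA hγ1) h.map_mul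

theorem ext_of_adjoin_eq_top (hA : (1 : R) ∈ A) (hγ1 : (γ ⟨1, hA⟩ : S) = 1)
    (hγ : IsLinearMap ℝ γ) (henv : Algebra.adjoin ℝ (A : Set R) = ⊤)
    (h : IsExtendedEncoding γ Γ) (h' : IsExtendedEncoding γ Γ') : Γ = Γ' := by
  have : h.toAlgHom hA hγ1 hγ = h'.toAlgHom hA hγ1 hγ := by
    apply AlgHom.ext_of_adjoin_eq_top henv
    intro a ha
    exact (h.extends_map ⟨a, ha⟩).trans (h'.extends_map ⟨a, ha⟩).symm
  exact congrArg DFunLike.coe this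

/-- The map `α ↦ star (Γ (star α))` is again an extended encoding of `γ`, since both Jordan algebras
consist of symmetric elements; uniqueness identifies it with `Γ`. -/
theorem map_star [StarRing R] [StarRing S] (hA : (1 : R) ∈ A)
    (hγ1 : (γ ⟨1, hA⟩ : S) = 1) (hγ : IsLinearMap ℝ γ)
    (henv : Algebra.adjoin ℝ (A : Set R) = ⊤) (hstarA : ∀ a ∈ A, star a = a)
    (hstarB : ∀ b ∈ B, star b = b) (h : IsExtendedEncoding γ Γ) (α : R) :
    Γ (star α) = star (Γ α) := by
  have h' : IsExtendedEncoding γ (fun α => star (Γ (star α))) :=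
    { extends_map := fun a => by rw [hstarA a a.2, h.extends_map, hstarB _ (γ a).2]
      map_add := fun x y => by rw [star_add, h.map_add, star_add]
      map_mul := fun x y => by rw [star_mul, h.map_mul, star_mul] }
  have := congrFun (ext_of_adjoin_eq_top hA hγ1 hγ henv h h') α
  rw [this, star_star]

end IsExtendedEncoding

end

end Encodings
-- Frames of minimal idempotents and Peirce components.
namespace Encodings

/-- A complete family of orthogonal minimal idempotents of a Jordan algebra. -/
structure IsFrame {R ι : Type*} [Ring R] [Algebra ℝ R] [Fintype ι] (A : Submodule ℝ R)
    (e : ι → R) : Prop where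
  mem : ∀ i, e i ∈ A
  mul_self : ∀ i, e i * e i = e i
  ne_zero : ∀ i, e i ≠ 0
  mul_of_ne : ∀ {i j}, i ≠ j → e i * e j = 0
  sum_eq_one : ∑ i, e i = 1
  minimal : ∀ i, ∀ a ∈ A, ∃ r : ℝ, e i * a * e i = r • e i

/-- A finite set of nonzero pairwise orthogonal idempotents of `A`. -/
structure IsOrthogonalSet {R : Type*} [Ring R] [Algebra ℝ R] (A : Submodule ℝ R)
    (s : Finset R) : Prop where
  mem : ∀ e ∈ s, e ∈ A
  mul_self : ∀ e ∈ s, e * e = e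
  ne_zero : ∀ e ∈ s, e ≠ 0
  mul_of_ne : ∀ e ∈ s, ∀ f ∈ s, e ≠ f → e * f = 0

section

variable {R : Type*} [Ring R] [Algebra ℝ R] {A : Submodule ℝ R}

namespace IsOrthogonalSet

theorem subset {s t : Finset R} (ht : IsOrthogonalSet A t) (h : s ⊆ t) : IsOrthogonalSet A s :=
  ⟨fun e he => ht.mem e (h he), fun e he => ht.mul_self e (h he), fun e he => ht.ne_zero e (h he),
    fun e he f hf => ht.mul_of_ne e (h he) f (h hf)⟩

theorem insert [DecidableEq R] {s : Finset R} (hs : IsOrthogonalSet A s) {g : R} (hgA : g ∈ A)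
    (hg : g * g = g) (hg0 : g ≠ 0) (h1 : ∀ e ∈ s, e * g = 0) (h2 : ∀ e ∈ s, g * e = 0) :
    IsOrthogonalSet A (insert g s) ∧ (insert g s).card = s.card + 1 := by
  refine ⟨⟨?_, ?_, ?_, ?_⟩, ?_⟩
  · simpa [hgA] using hs.mem
  · simpa [hg] using hs.mul_self
  · simpa [hg0] using hs.ne_zero
  · intro e he f hf hef
    rw [Finset.mem_insert] at he hf
    rcases he with rfl | he <;> rcases hf with rfl | hf
    · exact absurd rfl hef
    · exact h2 f hf
    · exact h1 e he
    · exact hs.mul_of_ne e he f hf hef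
  · apply Finset.card_insert_of_notMem
    intro h
    exact hg0 (hg ▸ h1 g h)

theorem card_le [FiniteDimensional ℝ A] {s : Finset R} (hs : IsOrthogonalSet A s) :
    s.card ≤ Module.finrank ℝ A := by
  classical
  have : LinearIndependent ℝ (fun x : s => (⟨x, hs.mem x x.2⟩ : A)) := by
    rw [Fintype.linearIndependent_iff]
    intro c hc i
    have h1 : ∑ x : s, c x • (x : R) = 0 := by simpa using congrArg Subtype.val hc
    have h2 : (∑ x : s, c x • (x : R)) * (i : R) = c i • (i : R) := by
      rw [Finset.sum_mul, Finset.sum_eq_single_of_mem i (Finset.mem_univ _), smul_mul_assoc,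
        hs.mul_self i i.2]
      intro x _ hx
      rw [smul_mul_assoc, hs.mul_of_ne x x.2 i i.2 (fun h => hx (Subtype.ext h)), smul_zero]
    rw [h1, zero_mul] at h2
    exact (smul_eq_zero.1 h2.symm).resolve_right (hs.ne_zero i i.2)
  simpa using this.fintype_card_le_finrank

/-- Otherwise the complement `1 - ∑ e` could be added to the set. -/
theorem sum_eq_one_of_maximal (hA : IsFormallyReal A) {s : Finset R} (hs : IsOrthogonalSet A s)
    (hmax : ∀ t, IsOrthogonalSet A t → t.card ≤ s.card) : ∑ e ∈ s, e = 1 := by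
  classical
  by_contra hne
  have hl : ∀ e ∈ s, e * ∑ f ∈ s, f = e := fun e he => by
    rw [Finset.mul_sum, Finset.sum_eq_single_of_mem e he, hs.mul_self e he]
    exact fun f hf hfe => hs.mul_of_ne e he f hf hfe.symm
  have hr : ∀ e ∈ s, (∑ f ∈ s, f) * e = e := fun e he => by
    rw [Finset.sum_mul, Finset.sum_eq_single_of_mem e he, hs.mul_self e he]
    exact fun f hf hfe => hs.mul_of_ne f hf e he hfe
  have hss : (∑ f ∈ s, f) * (∑ f ∈ s, f) = ∑ f ∈ s, f := by
    nth_rw 1 [Finset.sum_mul]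
    exact Finset.sum_congr rfl hl
  obtain ⟨h1, h2⟩ := hs.insert (g := 1 - ∑ f ∈ s, f)
    (A.sub_mem hA.one_mem (A.sum_mem hs.mem))
    (by rw [mul_sub, sub_mul, sub_mul, hss]; simp) (sub_ne_zero.2 (Ne.symm hne))
    (fun e he => by rw [mul_sub, hl e he, mul_one, sub_self])
    (fun e he => by rw [sub_mul, hr e he, one_mul, sub_self])
  have := hmax _ h1
  omega

/-- Otherwise replacing `e` by `f` and `e - f` would enlarge the set. -/
theorem eq_zero_or_eq_of_maximal {s : Finset R} (hs : IsOrthogonalSet A s)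
    (hmax : ∀ t, IsOrthogonalSet A t → t.card ≤ s.card) {e f : R} (he : e ∈ s) (hfA : f ∈ A)
    (hf : f * f = f) (hef : e * f = f) (hfe : f * e = f) : f = 0 ∨ f = e := by
  classical
  by_contra! h
  have hee := hs.mul_self e he
  have h1 : ∀ x ∈ s.erase e, x * e = 0 := fun x hx =>
    hs.mul_of_ne x (Finset.mem_of_mem_erase hx) e he (Finset.ne_of_mem_erase hx)
  have h2 : ∀ x ∈ s.erase e, e * x = 0 := fun x hx =>
    hs.mul_of_ne e he x (Finset.mem_of_mem_erase hx) (Finset.ne_of_mem_erase hx).symm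
  have h3 : ∀ x ∈ s.erase e, x * f = 0 := fun x hx => by
    rw [← hef, ← mul_assoc, h1 x hx, zero_mul]
  have h4 : ∀ x ∈ s.erase e, f * x = 0 := fun x hx => by
    rw [← hfe, mul_assoc, h2 x hx, mul_zero]
  obtain ⟨k1, k2⟩ := (hs.subset (Finset.erase_subset e s)).insert hfA hf h.1 h3 h4
  obtain ⟨k3, k4⟩ := k1.insert (g := e - f) (A.sub_mem (hs.mem e he) hfA)
    (by rw [mul_sub, sub_mul, sub_mul, hee, hef, hfe, hf]; simp) (sub_ne_zero.2 h.2.symm)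
    (by
      intro x hx
      rcases Finset.mem_insert.1 hx with rfl | hx
      · rw [mul_sub, hfe, hf, sub_self]
      · rw [mul_sub, h1 x hx, h3 x hx, sub_self])
    (by
      intro x hx
      rcases Finset.mem_insert.1 hx with rfl | hx
      · rw [sub_mul, hef, hf, sub_self]
      · rw [sub_mul, h2 x hx, h4 x hx, sub_self])
  have h5 := hmax _ k3
  have h6 := Finset.card_erase_add_one he
  omega

end IsOrthogonalSet

/-- Orthogonal idempotents are linearly independent, so a set of largest cardinality exists, and it
is a frame. -/
theorem IsFormallyReal.exists_frame (hA : IsFormallyReal A) :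
    ∃ s : Finset R, IsFrame A (Subtype.val : s → R) := by
  have := hA.finiteDimensional
  obtain ⟨s, hs, hmax⟩ : ∃ s, IsOrthogonalSet A s ∧
      ∀ t, IsOrthogonalSet A t → t.card ≤ s.card := by
    have hb : BddAbove {n | ∃ s, IsOrthogonalSet A s ∧ s.card = n} := by
      refine ⟨Module.finrank ℝ A, ?_⟩
      rintro _ ⟨s, hs, rfl⟩
      exact hs.card_le
    obtain ⟨s, hs, hcard⟩ := Nat.sSup_mem (s := {n | ∃ s, IsOrthogonalSet A s ∧ s.card = n})
      ⟨0, ∅, ⟨by simp, by simp, by simp, by simp⟩, rfl⟩ hb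
    exact ⟨s, hs, fun t ht => hcard ▸ le_csSup hb ⟨t, ht, rfl⟩⟩
  refine ⟨s, fun i => hs.mem i i.2, fun i => hs.mul_self i i.2, fun i => hs.ne_zero i i.2,
    fun {i j} hij => hs.mul_of_ne i i.2 j j.2 fun h => hij (Subtype.ext h), ?_, ?_⟩
  · rw [Finset.sum_coe_sort s fun e => e]
    exact hs.sum_eq_one_of_maximal hA hmax
  · rintro ⟨e, he⟩ a ha
    have hee := hs.mul_self e he
    obtain ⟨t, p, hpA, hcomm, hp, -, hb⟩ :=
      hA.exists_spectral_idempotents (hA.conj_mem ha (hs.mem e he))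
    have hel : e * (e * a * e) = e * a * e := by simp only [← mul_assoc, hee]
    have her : e * a * e * e = e * a * e := by rw [mul_assoc, hee]
    have hec : ∀ r, Commute e (p r) := fun r => hcomm r e (hel.trans her.symm)
    -- The spectral idempotents of `eae` commute with `e`, so their products with `e` are
    -- idempotents below `e`, hence 0 or `e`; thus `eae` is a multiple of `e`.
    have hep : ∀ r ∈ t, e * p r = 0 ∨ e * p r = e := fun r hr =>
      hs.eq_zero_or_eq_of_maximal hmax he
        (hA.mul_mem_of_commute (hs.mem e he) (hpA r) (hec r))
        (by rw [(hec r).symm.mul_mul_mul_comm, hee, hp r hr])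
        (by rw [← mul_assoc, hee]) (by rw [mul_assoc, ← (hec r).eq, ← mul_assoc, hee])
    have hmem : e * a * e ∈ Submodule.span ℝ {e} := by
      rw [← hel, ← hb, Finset.mul_sum]
      refine Submodule.sum_mem _ fun r hr => ?_
      rw [mul_smul_comm]
      refine Submodule.smul_mem _ _ ?_
      rcases hep r hr with h | h <;> rw [h]
      · exact Submodule.zero_mem _
      · exact Submodule.mem_span_singleton_self e
    obtain ⟨r, hr⟩ := Submodule.mem_span_singleton.1 hmem
    exact ⟨r, hr.symm⟩

namespace IsFrame

variable {ι : Type*} [Fintype ι] {e : ι → R} (he : IsFrame A e)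
include he

theorem mul_self_mul (i : ι) (x : R) : e i * (e i * x) = e i * x := by
  rw [← mul_assoc, he.mul_self]

theorem mul_mul_of_ne {i j : ι} (h : i ≠ j) (x : R) : e i * (e j * x) = 0 := by
  rw [← mul_assoc, he.mul_of_ne h, zero_mul]

theorem peirce_mem (hA : IsFormallyReal A) {a : R} (ha : a ∈ A) (i j : ι) :
    e i * a * e j + e j * a * e i ∈ A :=
  hA.triple_mem ha (he.mem i) (he.mem j)

/-- Each off-diagonal Peirce component carries a positive definite quadratic form. With `x`, `y` the
two halves of `b`, minimality gives `xy = r e_i` and `yx = t e_j`, and evaluating `xyx` in two ways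
gives `r = t`. -/
theorem peirce_mul_self (hA : IsFormallyReal A) {i j : ι} (hij : i ≠ j) {b : R} (hb : b ∈ A)
    (hbij : e i * b * e j + e j * b * e i = b) :
    ∃ r : ℝ, 0 ≤ r ∧ b * b = r • (e i + e j) ∧ (r = 0 → b = 0) := by
  obtain ⟨r, hr⟩ := he.minimal i _ (hA.sq_mem hb)
  obtain ⟨t, ht⟩ := he.minimal j _ (hA.sq_mem hb)
  set x := e i * b * e j with hx
  set y := e j * b * e i with hy
  have hxx : x * x = 0 := by simp only [hx, mul_assoc, he.mul_mul_of_ne hij.symm, mul_zero]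
  have hyy : y * y = 0 := by simp only [hy, mul_assoc, he.mul_mul_of_ne hij, mul_zero]
  have hix : e i * x = x := by simp only [hx, mul_assoc, he.mul_self_mul]
  have hjx : e j * x = 0 := by simp only [hx, mul_assoc, he.mul_mul_of_ne hij.symm]
  have hiy : e i * y = 0 := by simp only [hy, mul_assoc, he.mul_mul_of_ne hij]
  have hjy : e j * y = y := by simp only [hy, mul_assoc, he.mul_self_mul]
  have hyi : y * e i = y := by simp only [hy, mul_assoc, he.mul_self]
  have hxj : x * e j = x := by simp only [hx, mul_assoc, he.mul_self]
  have hxi : x * e i = 0 := by simp only [hx, mul_assoc, he.mul_of_ne hij.symm, mul_zero]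
  have hyj : y * e j = 0 := by simp only [hy, mul_assoc, he.mul_of_ne hij, mul_zero]
  have hbb : b * b = x * y + y * x := by
    rw [← hbij, add_mul, mul_add, mul_add, hxx, hyy, zero_add, add_zero]
  have hxy : x * y = r • e i := by
    have : e i * (x * y + y * x) * e i = (e i * x) * (y * e i) + (e i * y) * (x * e i) := by
      noncomm_ring
    rw [← hr, hbb, this, hix, hyi, hiy, zero_mul, add_zero]
  have hyx : y * x = t • e j := by
    have : e j * (x * y + y * x) * e j = (e j * x) * (y * e j) + (e j * y) * (x * e j) := by
      noncomm_ring
    rw [← ht, hbb, this, hjx, hjy, hxj, zero_mul, zero_add]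
  have hrt : r • x = t • x := by
    have h1 : x * y * x = r • x := by rw [hxy, smul_mul_assoc, hix]
    have h2 : x * y * x = t • x := by rw [mul_assoc, hyx, mul_smul_comm, hxj]
    rw [← h1, h2]
  have hrt' : r = t := by
    by_cases hx0 : x = 0
    · rw [hx0, zero_mul] at hxy
      rw [hx0, mul_zero] at hyx
      rw [(smul_eq_zero.1 hxy.symm).resolve_right (he.ne_zero i),
        (smul_eq_zero.1 hyx.symm).resolve_right (he.ne_zero j)]
    · exact smul_left_injective ℝ hx0 hrt
  have hbr : b * b = r • (e i + e j) := by rw [hbb, hxy, hyx, ← hrt', smul_add]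
  have hr0 : r = 0 → b = 0 := fun h => hA.eq_zero_of_sq hb (by rw [hbr, h, zero_smul])
  refine ⟨r, ?_, hbr, hr0⟩
  -- A negative `r` would make `b²` plus the square of `√(-r)(e_i + e_j)` vanish.
  by_contra! hneg
  have h0 := hA.eq_zero_of_sq_add_sq hb
    (A.smul_mem (√(-r)) (A.add_mem (he.mem i) (he.mem j))) (by
      rw [smul_mul_smul_comm, Real.mul_self_sqrt (by linarith), hbr, mul_add, add_mul, add_mul,
        he.mul_self, he.mul_self, he.mul_of_ne hij, he.mul_of_ne hij.symm]
      module)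
  rw [h0, zero_mul, smul_add] at hbr
  have h1 : e i * (r • e i + r • e j) = 0 := by rw [← hbr, mul_zero]
  rw [mul_add, mul_smul_comm, mul_smul_comm, he.mul_self, he.mul_of_ne hij, smul_zero,
    add_zero] at h1
  rw [(smul_eq_zero.1 h1).resolve_right (he.ne_zero i)] at hneg
  exact lt_irrefl _ hneg

theorem peirce_peirce {i j : ι} (hij : i ≠ j) (a : R) :
    e i * (e i * a * e j + e j * a * e i) * e j + e j * (e i * a * e j + e j * a * e i) * e i =
      e i * a * e j + e j * a * e i := by
  simp only [mul_add, mul_assoc, he.mul_self_mul, he.mul_mul_of_ne hij,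
    he.mul_mul_of_ne hij.symm, he.mul_self, add_zero, zero_add]

theorem mul_mul_eq_zero_symm (hA : IsFormallyReal A) {i j : ι} (hij : i ≠ j) {a : R} (ha : a ∈ A)
    (h : e i * a * e j = 0) : e j * a * e i = 0 := by
  have hm := he.peirce_mem hA ha i j
  rw [h, zero_add] at hm
  exact hA.eq_zero_of_sq hm (by simp only [mul_assoc, he.mul_mul_of_ne hij, mul_zero])

/-- Nonzero Peirce components compose. -/
theorem mul_mul_eq_zero_of_not_connected (hA : IsFormallyReal A) {o i j : ι} (hoi : o ≠ i)
    (hij : i ≠ j) (hoj : o ≠ j) {a c : R} (ha : a ∈ A) (hc : c ∈ A) (hne : e o * a * e i ≠ 0)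
    (h0 : ∀ a ∈ A, e o * a * e j = 0) : e i * c * e j = 0 := by
  have hb := he.peirce_mem hA ha o i
  have hd := he.peirce_mem hA hc i j
  obtain ⟨r, -, hr, hr0⟩ := he.peirce_mul_self hA hoi hb (he.peirce_peirce hoi a)
  have hb0 : e o * a * e i + e i * a * e o ≠ 0 := by
    intro h
    apply hne
    have : e o * (e o * a * e i + e i * a * e o) = 0 := by rw [h, mul_zero]
    simpa only [mul_add, mul_assoc, he.mul_self_mul, he.mul_mul_of_ne hoi, add_zero] using this
  have hr0' : r ≠ 0 := fun h => hb0 (hr0 h)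
  -- The `(o, j)` component of this Jordan product is `e_o a e_i c e_j`. Multiplying it by `e_i a`
  -- on the left gives `r e_i c e_j` with `r ≠ 0`.
  have h1 := h0 _ (hA.mul_add_mul_mem hb hd)
  have h2 : e o * a * e i * c * e j = 0 := by
    simpa only [mul_add, add_mul, mul_assoc, he.mul_self_mul, he.mul_self, he.mul_mul_of_ne hoi,
      he.mul_mul_of_ne hij, he.mul_mul_of_ne hoj, he.mul_mul_of_ne hoi.symm, mul_zero, zero_mul,
      add_zero, zero_add, he.mul_mul_of_ne hoj.symm, he.mul_mul_of_ne hij.symm] using h1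
  have h3 : e i * a * e o * a * e i = r • e i := by
    have := congrArg (fun z => e i * z * e i) hr
    simpa only [mul_add, add_mul, mul_assoc, he.mul_self_mul, he.mul_self, he.mul_mul_of_ne hoi,
      he.mul_of_ne hoi, he.mul_mul_of_ne hoi.symm, mul_zero, zero_mul, smul_mul_assoc,
      mul_smul_comm, smul_add, smul_zero,
      add_zero, zero_add] using this
  have h4 : r • (e i * c * e j) = 0 := by
    rw [← smul_mul_assoc, ← smul_mul_assoc, ← h3]
    have := congrArg (fun z => e i * a * z) h2
    simpa only [mul_assoc, he.mul_self_mul, mul_zero] using this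
  exact (smul_eq_zero.1 h4).resolve_left hr0'

/-- If not, let `E` be the sum of the idempotents connected to `e o`. Since connection is
transitive, `E` commutes with `A`, and the part of `A` fixed by `E` is a Jordan ideal containing `e
o` but not `e j`. -/
theorem exists_connected (hA : IsFormallyReal A) (hs : IsSimpleJordan A) (o j : ι) (hoj : o ≠ j) :
    ∃ a ∈ A, e o * a * e j ≠ 0 := by
  classical
  by_contra! hj
  set K : Finset ι := {i | i = o ∨ ∃ a ∈ A, e o * a * e i ≠ 0} with hK
  have hoK : o ∈ K := by simp [hK]
  have hjK : j ∉ K := by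
    simp only [hK, Finset.mem_filter, Finset.mem_univ, true_and, not_or, not_exists, not_and,
      not_not]
    exact ⟨hoj.symm, hj⟩
  have hsep : ∀ i ∈ K, ∀ k ∉ K, ∀ a ∈ A, e i * a * e k = 0 := by
    intro i hi k hk a ha
    have hik : i ≠ k := fun h => hk (h ▸ hi)
    simp only [hK, Finset.mem_filter, Finset.mem_univ, true_and, not_or, not_exists, not_and,
      not_not] at hi hk
    rcases hi with rfl | ⟨c, hc, hci⟩
    · exact hk.2 a ha
    · rcases eq_or_ne i o with rfl | hio
      · exact hk.2 a ha
      · exact he.mul_mul_eq_zero_of_not_connected hA hio.symm hik (Ne.symm hk.1) hc ha hci hk.2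
  have hsep' : ∀ i ∈ K, ∀ k ∉ K, ∀ a ∈ A, e k * a * e i = 0 := fun i hi k hk a ha =>
    he.mul_mul_eq_zero_symm hA (fun h : i = k => hk (h ▸ hi)) ha (hsep i hi k hk a ha)
  set E := ∑ i ∈ K, e i with hE
  have hE1 : 1 - E = ∑ i ∈ Kᶜ, e i := by
    rw [sub_eq_iff_eq_add, ← he.sum_eq_one, hE, add_comm, Finset.sum_add_sum_compl]
  have h1 : ∀ a ∈ A, E * a * (1 - E) = 0 := fun a ha => by
    rw [hE1, Finset.sum_mul, Finset.sum_mul_sum]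
    exact Finset.sum_eq_zero fun i hi => Finset.sum_eq_zero fun k hk =>
      hsep i hi k (Finset.mem_compl.1 hk) a ha
  have h2 : ∀ a ∈ A, (1 - E) * a * E = 0 := fun a ha => by
    rw [hE1, Finset.sum_mul, Finset.sum_mul_sum]
    exact Finset.sum_eq_zero fun k hk => Finset.sum_eq_zero fun i hi =>
      hsep' i hi k (Finset.mem_compl.1 hk) a ha
  have hcomm : ∀ a ∈ A, E * a = a * E := fun a ha => by
    have k1 := h1 a ha
    have k2 := h2 a ha
    rw [mul_sub, mul_one, sub_eq_zero] at k1
    rw [sub_mul, one_mul, sub_mul, sub_eq_zero] at k2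
    rw [k1, k2]
  have hEi : ∀ i ∈ K, E * e i = e i := fun i hi => by
    rw [hE, Finset.sum_mul, Finset.sum_eq_single_of_mem i hi, he.mul_self]
    exact fun k _ hki => he.mul_of_ne hki
  have hEj : E * e j = 0 := by
    rw [hE, Finset.sum_mul]
    exact Finset.sum_eq_zero fun k hk => he.mul_of_ne fun h => hjK (h ▸ hk)
  let I : Submodule ℝ R :=
    { carrier := {x | x ∈ A ∧ E * x = x}
      add_mem' := fun {x y} hx hy => ⟨A.add_mem hx.1 hy.1, by rw [mul_add, hx.2, hy.2]⟩
      zero_mem' := ⟨A.zero_mem, mul_zero _⟩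
      smul_mem' := fun r x hx => ⟨A.smul_mem r hx.1, by rw [mul_smul_comm, hx.2]⟩ }
  rcases hs.2 I (fun x hx => hx.1) (fun a ha x hx => by
    refine ⟨A.smul_mem _ (hA.mul_add_mul_mem ha hx.1), ?_⟩
    rw [jordanProd, mul_smul_comm, mul_add, ← mul_assoc, hcomm a ha, mul_assoc, hx.2, ← mul_assoc,
      hx.2]) with h | h
  · have : e o ∈ I := ⟨he.mem o, hEi o hoK⟩
    rw [h] at this
    exact he.ne_zero o this
  · have : e j ∈ I := h ▸ he.mem j
    exact he.ne_zero j (this.2.symm.trans hEj)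

theorem exists_symmetry (hA : IsFormallyReal A) (hs : IsSimpleJordan A) (o j : ι) (hoj : o ≠ j) :
    ∃ u ∈ A, e o * u * e j + e j * u * e o = u ∧ u * u = e o + e j := by
  obtain ⟨a, ha, hne⟩ := he.exists_connected hA hs o j hoj
  have hb := he.peirce_mem hA ha o j
  have hbp := he.peirce_peirce hoj a
  obtain ⟨r, hr, hbb, hr0⟩ := he.peirce_mul_self hA hoj hb hbp
  have hb0 : e o * a * e j + e j * a * e o ≠ 0 := by
    intro h
    apply hne
    have : e o * (e o * a * e j + e j * a * e o) = 0 := by rw [h, mul_zero]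
    simpa only [mul_add, mul_assoc, he.mul_self_mul, he.mul_mul_of_ne hoj, add_zero] using this
  have hrpos : 0 < r := lt_of_le_of_ne hr fun h => hb0 (hr0 h.symm)
  refine ⟨(√r)⁻¹ • (e o * a * e j + e j * a * e o), A.smul_mem _ hb, ?_, ?_⟩
  · rw [mul_smul_comm, smul_mul_assoc, mul_smul_comm, smul_mul_assoc, ← smul_add, hbp]
  · rw [smul_mul_smul_comm, hbb, smul_smul, ← mul_inv, Real.mul_self_sqrt hr,
      inv_mul_cancel₀ hrpos.ne', one_smul]

end IsFrame

end

end Encodings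
-- Matrix units, and simplicity for three or more idempotents.
namespace Encodings

/-- Matrix units `F j = E_{oj}`, `G j = E_{jo}` adapted to a frame `e` of a Jordan algebra `A`. -/
structure IsMatrixUnits {R ι : Type*} [Ring R] [Algebra ℝ R] (A : Submodule ℝ R)
    (e : ι → R) (o : ι) (F G : ι → R) : Prop where
  left_F : ∀ j, e o * F j = F j
  F_right : ∀ j, F j * e j = F j
  left_G : ∀ j, e j * G j = G j
  G_right : ∀ j, G j * e o = G j
  F_mul_G : ∀ j, F j * G j = e o
  G_mul_F : ∀ j, G j * F j = e j
  F_self : F o = e o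
  G_self : G o = e o
  mem : ∀ {j k}, j ≠ k → G j * F k + G k * F j ∈ A

theorem _root_.TwoSidedIdeal.real_smul_mem {R : Type*} [Ring R] [Algebra ℝ R]
    (I : TwoSidedIdeal R) (r : ℝ) {x : R} (hx : x ∈ I) : r • x ∈ I := by
  rw [Algebra.smul_def]
  exact I.mul_mem_left _ _ hx

section

variable {R ι : Type*} [Ring R] [Algebra ℝ R] {A : Submodule ℝ R} [Fintype ι] {e : ι → R}

theorem IsFrame.exists_matrixUnits (he : IsFrame A e) (hA : IsFormallyReal A)
    (hs : IsSimpleJordan A) (o : ι) : ∃ F G : ι → R, IsMatrixUnits A e o F G := by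
  classical
  have h : ∀ j, ∃ u, j ≠ o → u ∈ A ∧ e o * u * e j + e j * u * e o = u ∧ u * u = e o + e j := by
    intro j
    by_cases hj : j = o
    · exact ⟨0, fun h => absurd hj h⟩
    · obtain ⟨u, hu⟩ := he.exists_symmetry hA hs o j (Ne.symm hj)
      exact ⟨u, fun _ => hu⟩
  choose u hu using h
  let F : ι → R := fun j => if j = o then e o else e o * u j * e j
  let G : ι → R := fun j => if j = o then e o else e j * u j * e o
  have hFo : F o = e o := if_pos rfl
  have hGo : G o = e o := if_pos rfl
  have hF : ∀ j, j ≠ o → F j = e o * u j * e j := fun j hj => if_neg hj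
  have hG : ∀ j, j ≠ o → G j = e j * u j * e o := fun j hj => if_neg hj
  have hFG : ∀ j, j ≠ o → F j + G j = u j := fun j hj => by
    rw [hF j hj, hG j hj]; exact (hu j hj).2.1
  have lF : ∀ j, e o * F j = F j := fun j => by
    by_cases hj : j = o
    · rw [hj, hFo, he.mul_self]
    · rw [hF j hj]; simp only [mul_assoc, he.mul_self_mul]
  have rF : ∀ j, F j * e j = F j := fun j => by
    by_cases hj : j = o
    · rw [hj, hFo, he.mul_self]
    · rw [hF j hj]; simp only [mul_assoc, he.mul_self]
  have lG : ∀ j, e j * G j = G j := fun j => by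
    by_cases hj : j = o
    · rw [hj, hGo, he.mul_self]
    · rw [hG j hj]; simp only [mul_assoc, he.mul_self_mul]
  have rG : ∀ j, G j * e o = G j := fun j => by
    by_cases hj : j = o
    · rw [hj, hGo, he.mul_self]
    · rw [hG j hj]; simp only [mul_assoc, he.mul_self]
  have FF : ∀ j k, j ≠ o → F j * F k = 0 := fun j k hj => by
    rw [← rF j, ← lF k, mul_assoc, he.mul_mul_of_ne hj, mul_zero]
  have GG : ∀ j k, k ≠ o → G j * G k = 0 := fun j k hk => by
    rw [← rG j, ← lG k, mul_assoc, he.mul_mul_of_ne hk.symm, mul_zero]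
  have FG : ∀ j k, j ≠ k → F j * G k = 0 := fun j k hjk => by
    rw [← rF j, ← lG k, mul_assoc, he.mul_mul_of_ne hjk, mul_zero]
  have hsq : ∀ j, j ≠ o → F j * G j + G j * F j = e o + e j := fun j hj => by
    rw [← (hu j hj).2.2, ← hFG j hj, add_mul, mul_add, mul_add, FF j j hj, GG j j hj, zero_add,
      add_zero]
  refine ⟨F, G, lF, rF, lG, rG, fun j => ?_, fun j => ?_, hFo, hGo, ?_⟩
  · by_cases hj : j = o
    · rw [hj, hFo, hGo, he.mul_self]
    · have := congrArg (fun z => e o * z) (hsq j hj)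
      rwa [mul_add, mul_add, ← mul_assoc, lF, ← lG j, ← mul_assoc (e o), ← mul_assoc (e o),
        he.mul_of_ne (Ne.symm hj), zero_mul, zero_mul, add_zero, lG, he.mul_self, add_zero] at this
  · by_cases hj : j = o
    · rw [hj, hFo, hGo, he.mul_self]
    · have := congrArg (fun z => e j * z) (hsq j hj)
      rwa [mul_add, mul_add, ← mul_assoc, ← lF j, ← mul_assoc (e j), he.mul_of_ne hj, zero_mul,
        zero_mul, zero_add, zero_add, ← mul_assoc, lG, lF, he.mul_self] at this
  · have key : ∀ k, k ≠ o → G o * F k + G k * F o ∈ A := fun k hk => by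
      rw [hGo, hFo, lF, rG, hFG k hk]
      exact (hu k hk).1
    intro j k hjk
    by_cases hj : j = o
    · subst hj; exact key k hjk.symm
    by_cases hk : k = o
    · subst hk; rw [add_comm]; exact key j hj
    -- For `j`, `k` and `o` distinct, the Jordan product of the symmetries `u j` and `u k` is
    -- exactly `G j * F k + G k * F j`.
    have := hA.mul_add_mul_mem (hu j hj).1 (hu k hk).1
    rwa [← hFG j hj, ← hFG k hk, add_mul, mul_add, mul_add, add_mul, mul_add, mul_add,
      FF j k hj, FF k j hk, GG j k hk, GG k j hj, FG j k hjk, FG k j hjk.symm,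
      zero_add, zero_add, add_zero, add_zero, zero_add] at this

namespace IsMatrixUnits

variable {o : ι} {F G : ι → R} (hm : IsMatrixUnits A e o F G)

/-- The elements `E_{oi} a E_{jo}` with `a ∈ A`. -/
def coord (A : Submodule ℝ R) (F G : ι → R) (i j : ι) : Submodule ℝ R :=
  A.map (LinearMap.mulLeft ℝ (F i) ∘ₗ LinearMap.mulRight ℝ (G j))

omit [Fintype ι] in
theorem mem_coord {i j : ι} {x : R} : x ∈ coord A F G i j ↔ ∃ a ∈ A, F i * (a * G j) = x :=
  Iff.rfl

include hm

omit [Fintype ι] in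
theorem F_mul_G_mul (j : ι) (x : R) : F j * (G j * x) = e o * x := by
  rw [← mul_assoc, hm.F_mul_G]

theorem F_mul_G_of_ne (he : IsFrame A e) {i j : ι} (hij : i ≠ j) : F i * G j = 0 := by
  rw [← hm.F_right, ← hm.left_G, mul_assoc, he.mul_mul_of_ne hij, mul_zero]

theorem F_mul_G_mul_of_ne (he : IsFrame A e) {i j : ι} (hij : i ≠ j) (x : R) :
    F i * (G j * x) = 0 := by
  rw [← mul_assoc, hm.F_mul_G_of_ne he hij, zero_mul]

/-- Jordan multiplication by `G j * F k + G k * F j` moves the column index from `j` to `k`. -/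
theorem coord_le_right (he : IsFrame A e) (hA : IsFormallyReal A) {i j k : ι} (hij : i ≠ j)
    (hkj : k ≠ j) (hki : k ≠ i) : coord A F G i j ≤ coord A F G i k := by
  intro x hx
  obtain ⟨a, ha, rfl⟩ := mem_coord.1 hx
  refine mem_coord.2 ⟨_, hA.mul_add_mul_mem ha (hm.mem hkj.symm), ?_⟩
  simp only [mul_add, add_mul, mul_assoc, hm.F_mul_G, hm.F_mul_G_of_ne he hkj.symm,
    hm.F_mul_G_mul_of_ne he hij, hm.F_mul_G_mul_of_ne he hki.symm, mul_zero, add_zero, hm.G_right]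

theorem coord_le_left (he : IsFrame A e) (hA : IsFormallyReal A) {i j k : ι} (hij : i ≠ j)
    (hkj : k ≠ j) (hki : k ≠ i) : coord A F G i j ≤ coord A F G k j := by
  intro x hx
  obtain ⟨a, ha, rfl⟩ := mem_coord.1 hx
  refine mem_coord.2 ⟨_, hA.mul_add_mul_mem ha (hm.mem hki), ?_⟩
  simp only [mul_add, add_mul, mul_assoc, hm.F_mul_G_mul, hm.F_mul_G_of_ne he hkj,
    hm.F_mul_G_of_ne he hij, hm.F_mul_G_mul_of_ne he hki, mul_zero, add_zero, zero_add]
  rw [← mul_assoc (e o), hm.left_F]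

/-- Rows and columns are changed one at a time without meeting the diagonal; when `k = j`, a third
index `m` provides the detour. -/
theorem coord_le (he : IsFrame A e) (hA : IsFormallyReal A) (h3 : ∀ i j : ι, ∃ k, k ≠ i ∧ k ≠ j)
    {i j k l : ι} (hij : i ≠ j) (hkl : k ≠ l) : coord A F G i j ≤ coord A F G k l := by
  have hr : ∀ {i j k : ι}, i ≠ j → i ≠ k → coord A F G i j ≤ coord A F G i k := by
    intro i j k hij hik
    rcases eq_or_ne k j with rfl | hkj
    · exact le_rfl
    · exact hm.coord_le_right he hA hij hkj hik.symm
  have hl : ∀ {i j k : ι}, i ≠ j → k ≠ j → coord A F G i j ≤ coord A F G k j := by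
    intro i j k hij hkj
    rcases eq_or_ne k i with rfl | hki
    · exact le_rfl
    · exact hm.coord_le_left he hA hij hkj hki
  rcases eq_or_ne k j with rfl | hkj
  · obtain ⟨m, hmi, hmk⟩ := h3 i k
    exact (hr hij hmi.symm).trans ((hl hmi.symm hmk.symm).trans (hr hmk.symm hkl))
  · exact (hl hij hkj).trans (hr hkj hkl)

theorem e_mem_coord (he : IsFrame A e) {p : ι} (hop : o ≠ p) : e o ∈ coord A F G o p := by
  refine mem_coord.2 ⟨_, hm.mem hop, ?_⟩
  simp only [add_mul, mul_assoc, hm.F_mul_G, hm.F_mul_G_of_ne he hop, mul_zero, add_zero,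
    hm.G_right]

theorem F_mul_peirce_mul_G (he : IsFrame A e) {i j : ι} (hij : i ≠ j) (a : R) :
    F i * ((e i * a * e j + e j * a * e i) * G j) = F i * (a * G j) := by
  have h1 : ∀ x, F i * (e i * x) = F i * x := fun x => by rw [← mul_assoc, hm.F_right]
  have h2 : ∀ x, F i * (e j * x) = 0 := fun x => by
    rw [← hm.F_right i, mul_assoc, he.mul_mul_of_ne hij, mul_zero]
  simp only [add_mul, mul_add, mul_assoc, h1, h2, hm.left_G, add_zero]

/-- For distinct indices, the associative product of the entries is the `(i, k)` entry of the Jordan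
product of the two Peirce components. -/
theorem mul_mem_coord (he : IsFrame A e) (hA : IsFormallyReal A) {i j k : ι} (hij : i ≠ j)
    (hjk : j ≠ k) (hik : i ≠ k) {x y : R} (hx : x ∈ coord A F G i j) (hy : y ∈ coord A F G j k) :
    x * y ∈ coord A F G i k := by
  obtain ⟨a, ha, rfl⟩ := mem_coord.1 hx
  obtain ⟨b, hb, rfl⟩ := mem_coord.1 hy
  refine mem_coord.2 ⟨_, hA.mul_add_mul_mem (he.peirce_mem hA ha i j)
    (he.peirce_mem hA hb j k), ?_⟩
  have h1 : ∀ z, F i * (e i * z) = F i * z := fun z => by rw [← mul_assoc, hm.F_right]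
  have h2 : ∀ {l}, i ≠ l → ∀ z, F i * (e l * z) = 0 := fun h z => by
    rw [← hm.F_right i, mul_assoc, he.mul_mul_of_ne h, mul_zero]
  have h3 : e j * G k = 0 := by rw [← hm.left_G, he.mul_mul_of_ne hjk]
  have h4 : ∀ z, G j * (F j * z) = e j * z := fun z => by rw [← mul_assoc, hm.G_mul_F]
  simp only [add_mul, mul_add, mul_assoc, h1, h2 hij, h2 hik, h3, h4, hm.left_G,
    he.mul_self_mul, he.mul_mul_of_ne hij, he.mul_mul_of_ne hjk, mul_zero, zero_mul, add_zero]

/-- One space contains all matrix entries of the enveloping algebra: it contains those of the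
generators, diagonal ones being multiples of `e o` by minimality, and it is closed under products.
-/
theorem F_mul_mul_G_mem (he : IsFrame A e) (hA : IsFormallyReal A)
    (h3 : ∀ i j : ι, ∃ k, k ≠ i ∧ k ≠ j) (henv : Algebra.adjoin ℝ (A : Set R) = ⊤)
    {p : ι} (hop : o ≠ p) (x : R) : ∀ i j, F i * (x * G j) ∈ coord A F G o p := by
  have hx : x ∈ Algebra.adjoin ℝ (A : Set R) := henv ▸ Algebra.mem_top
  induction hx using Algebra.adjoin_induction with
  | mem a ha =>
    intro i j
    rcases eq_or_ne i j with rfl | hij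
    · obtain ⟨r, hr⟩ := he.minimal i a ha
      rw [← hm.F_right i, ← hm.left_G i, mul_assoc, ← mul_assoc a, ← mul_assoc (e i),
        ← mul_assoc (e i), hr, smul_mul_assoc, hm.left_G, mul_smul_comm, hm.F_mul_G]
      exact Submodule.smul_mem _ _ (hm.e_mem_coord he hop)
    · exact hm.coord_le he hA h3 hij hop (mem_coord.2 ⟨a, ha, rfl⟩)
  | algebraMap r =>
    intro i j
    rw [← Algebra.smul_def, mul_smul_comm]
    refine Submodule.smul_mem _ _ ?_
    rcases eq_or_ne i j with rfl | hij
    · rw [hm.F_mul_G]; exact hm.e_mem_coord he hop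
    · rw [hm.F_mul_G_of_ne he hij]; exact Submodule.zero_mem _
  | add x y _ _ hx hy =>
    intro i j
    rw [add_mul, mul_add]
    exact Submodule.add_mem _ (hx i j) (hy i j)
  | mul x y _ _ hx hy =>
    intro i j
    -- Matrix multiplication, from inserting `1 = ∑ G k * F k` between the factors.
    have h : F i * (x * y * G j) = ∑ k, (F i * (x * G k)) * (F k * (y * G j)) := by
      conv_lhs => rw [← mul_one x, ← he.sum_eq_one, Finset.mul_sum, Finset.sum_mul, Finset.sum_mul,
        Finset.mul_sum]
      refine Finset.sum_congr rfl fun k _ => ?_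
      rw [← hm.G_mul_F k]
      simp only [mul_assoc]
    rw [h]
    refine Submodule.sum_mem _ fun k _ => ?_
    -- The factors are placed at positions `(o, p)` and `(p, m)`, so that the three indices are
    -- distinct.
    obtain ⟨m, hmo, hmp⟩ := h3 o p
    exact hm.coord_le he hA h3 hmo.symm hop (hm.mul_mem_coord he hA hop hmp.symm hmo.symm
      (hx i k)
      (hm.coord_le he hA h3 hop hmp.symm (hy k j)))

/-- Up to a matrix unit `x` is a Peirce element `b` with `b²` a nonzero multiple of `e o + e p`, so
`b` provides the inverse. -/
theorem exists_right_inv (he : IsFrame A e) (hA : IsFormallyReal A) {p : ι} (hop : o ≠ p) {x : R}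
    (hx : x ∈ coord A F G o p) (hx0 : x ≠ 0) : ∃ y, x * y = e o := by
  obtain ⟨a, ha, rfl⟩ := mem_coord.1 hx
  obtain ⟨r, -, hr, hr0⟩ := he.peirce_mul_self hA hop (he.peirce_mem hA ha o p)
    (he.peirce_peirce hop a)
  rw [← hm.F_mul_peirce_mul_G he hop] at hx0 ⊢
  set b := e o * a * e p + e p * a * e o with hb
  have hr1 : r ≠ 0 := fun h => hx0 (by rw [hr0 h, zero_mul, mul_zero])
  have hob : e o * b = b * e p := by
    simp only [hb, mul_add, add_mul, mul_assoc, he.mul_self_mul, he.mul_mul_of_ne hop,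
      he.mul_self, he.mul_of_ne hop, mul_zero, add_zero]
  refine ⟨r⁻¹ • (F p * (b * e o)), ?_⟩
  have h1 : F o * (b * G p) * (F p * (b * e o)) = e o * b * (e p * b * e o) := by
    rw [hm.F_self, ← hm.G_mul_F p]; simp only [mul_assoc]
  have h2 : e o * b * (e p * b * e o) = r • e o := by
    calc e o * b * (e p * b * e o) = e o * (b * e p) * b * e o := by simp only [mul_assoc]
      _ = e o * (b * b) * e o := by rw [← hob, ← mul_assoc, he.mul_self]; simp only [mul_assoc]
      _ = r • e o := by
        rw [hr, mul_smul_comm, smul_mul_assoc, mul_add, he.mul_self, he.mul_of_ne hop, add_zero,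
          he.mul_self]
  rw [mul_smul_comm, h1, h2, inv_smul_smul₀ hr1]

/-- Some matrix entry of `x` is nonzero, hence right invertible in the corner; so `e o` lies in the
ideal, and matrix units carry it to every `e k`. -/
theorem one_mem_of_ne_zero (he : IsFrame A e) (hA : IsFormallyReal A)
    (h3 : ∀ i j : ι, ∃ k, k ≠ i ∧ k ≠ j) (henv : Algebra.adjoin ℝ (A : Set R) = ⊤)
    (I : TwoSidedIdeal R) {x : R} (hxI : x ∈ I) (hx0 : x ≠ 0) : (1 : R) ∈ I := by
  obtain ⟨p, hpo, -⟩ := h3 o o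
  obtain ⟨i, j, hij⟩ : ∃ i j, e i * x * e j ≠ 0 := by
    by_contra! h
    apply hx0
    rw [← one_mul x, ← mul_one (1 * x), ← he.sum_eq_one, Finset.sum_mul, Finset.sum_mul_sum]
    exact Finset.sum_eq_zero fun i _ => Finset.sum_eq_zero fun j _ => h i j
  have hz0 : F i * (x * G j) ≠ 0 := by
    intro h
    apply hij
    rw [← hm.G_mul_F i, ← hm.G_mul_F j]
    calc G i * F i * x * (G j * F j) = G i * (F i * (x * G j)) * F j := by simp only [mul_assoc]
      _ = 0 := by rw [h, mul_zero, zero_mul]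
  obtain ⟨y, hy⟩ := hm.exists_right_inv he hA hpo.symm
    (hm.F_mul_mul_G_mem he hA h3 henv hpo.symm x i j) hz0
  have ho : e o ∈ I := by
    rw [← hy]
    exact I.mul_mem_right _ _ (I.mul_mem_left _ _ (I.mul_mem_right _ _ hxI))
  rw [← he.sum_eq_one]
  refine sum_mem fun k _ => ?_
  rw [← hm.G_mul_F k, ← hm.left_F]
  exact I.mul_mem_left _ _ (I.mul_mem_right _ _ ho)

end IsMatrixUnits

end

end Encodings
-- Frames of at most two idempotents: spin factors.
namespace Encodings

/-- Pairwise anticommuting square roots of `1`. -/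
structure IsCliffordSystem {R ι : Type*} [Ring R] (v : ι → R) : Prop where
  mul_self : ∀ i, v i * v i = 1
  mul_of_ne : ∀ {i j}, i ≠ j → v i * v j = -(v j * v i)

section

variable {R : Type*} [Ring R] [Algebra ℝ R]

/-- The orthonormal basis of a space of elements with positive scalar squares. -/
theorem exists_cliffordSystem [Nontrivial R] (V : Submodule ℝ R) [FiniteDimensional ℝ V]
    (hV : ∀ v ∈ V, ∃ r : ℝ, 0 ≤ r ∧ v * v = r • (1 : R) ∧ (r = 0 → v = 0)) :
    ∃ v : Fin (Module.finrank ℝ V) → R, IsCliffordSystem v ∧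
      Submodule.span ℝ (Set.range v) = V := by
  have hinj : Function.Injective fun r : ℝ => r • (1 : R) := smul_left_injective ℝ one_ne_zero
  have hpol : ∀ v w : V, ∃ r : ℝ, (v * w + w * v : R) = (2 * r) • (1 : R) := by
    intro v w
    obtain ⟨r, -, hr, -⟩ := hV _ (V.add_mem v.2 w.2)
    obtain ⟨s, -, hs, -⟩ := hV _ v.2
    obtain ⟨t, -, ht, -⟩ := hV _ w.2
    refine ⟨(r - s - t) / 2, ?_⟩
    rw [mul_div_cancel₀ _ two_ne_zero, sub_smul, sub_smul, ← hr, ← hs, ← ht]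
    noncomm_ring
  choose B hB using hpol
  have hB' : ∀ {v w : V} {r : ℝ}, (v * w + w * v : R) = (2 * r) • (1 : R) → B v w = r := by
    intro v w r h
    have := hinj ((hB v w).symm.trans h)
    linarith
  have hBself : ∀ v : V, (v * v : R) = (B v v) • (1 : R) := by
    intro v
    have := hB v v
    rw [← two_smul ℝ (v * v : R), mul_smul] at this
    exact smul_right_injective R (two_ne_zero (α := ℝ)) this
  -- Half the anticommutator is an inner product, so orthonormal vectors square to 1 and
  -- anticommute.
  let core : InnerProductSpace.Core ℝ V :=
    { inner := B
      conj_inner_symm := fun v w => by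
        apply hB'
        rw [add_comm]
        exact hB v w
      re_inner_nonneg := fun v => by
        obtain ⟨r, hr0, hr, -⟩ := hV _ v.2
        have : B v v = r := hinj ((hBself v).symm.trans hr)
        simpa [this] using hr0
      add_left := fun u v w => by
        apply hB'
        rw [mul_add, add_smul, ← hB, ← hB]
        simp only [Submodule.coe_add]
        noncomm_ring
      smul_left := fun v w r => by
        apply hB'
        simp only [conj_trivial]
        rw [mul_left_comm, mul_smul, ← hB]
        simp
      definite := fun v h => by
        obtain ⟨r, -, hr, hr0⟩ := hV _ v.2
        have : B v v = r := hinj ((hBself v).symm.trans hr)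
        exact Subtype.ext (hr0 (this.symm.trans h)) }
  let : NormedAddCommGroup V := core.toNormedAddCommGroup
  let : InnerProductSpace ℝ V := InnerProductSpace.ofCore core.toCore
  let b := stdOrthonormalBasis ℝ V
  have hb : ∀ i j, B (b i) (b j) = if i = j then 1 else 0 :=
    orthonormal_iff_ite.1 b.orthonormal
  refine ⟨fun i => (b i : R), ⟨fun i => ?_, fun {i j} hij => ?_⟩, ?_⟩
  · rw [hBself, hb, if_pos rfl, one_smul]
  · rw [eq_neg_iff_add_eq_zero, hB, hb, if_neg hij, mul_zero, zero_smul]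
  · have h1 : Submodule.span ℝ (Set.range b) = ⊤ := by
      rw [← b.coe_toBasis]; exact b.toBasis.span_eq
    have h2 : Set.range (fun i => (b i : R)) = V.subtype '' Set.range b := by
      rw [← Set.range_comp]; rfl
    rw [h2, Submodule.span_image, h1, Submodule.map_top, Submodule.range_subtype]

theorem finrank_span_one_sup [Nontrivial R] (V : Submodule ℝ R) [FiniteDimensional ℝ V]
    (h1 : (1 : R) ∉ V) :
    Module.finrank ℝ (Submodule.span ℝ {(1 : R)} ⊔ V : Submodule ℝ R) =
      Module.finrank ℝ V + 1 := by
  have h : Submodule.span ℝ {(1 : R)} ⊓ V = ⊥ := by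
    rw [eq_bot_iff]
    rintro x ⟨hx1, hx2⟩
    obtain ⟨r, rfl⟩ := Submodule.mem_span_singleton.1 hx1
    by_contra hx
    have hr : r ≠ 0 := by rintro rfl; simp at hx
    apply h1
    have := V.smul_mem r⁻¹ hx2
    rwa [inv_smul_smul₀ hr] at this
  have := Submodule.finrank_sup_add_finrank_inf_eq (Submodule.span ℝ {(1 : R)}) V
  rw [h, finrank_bot, finrank_span_singleton one_ne_zero] at this
  omega

/-- `A` is spanned by `1` and a Clifford system. -/
def IsSpinBasis {k : ℕ} (A : Submodule ℝ R) (v : Fin k → R) : Prop :=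
  IsCliffordSystem v ∧ Submodule.span ℝ {(1 : R)} ⊔ Submodule.span ℝ (Set.range v) = A ∧
    Module.finrank ℝ A = k + 1

theorem exists_spinBasis_of_submodule [Nontrivial R] {A : Submodule ℝ R} (hA : IsFormallyReal A)
    (V : Submodule ℝ R) (hVA : V ≤ A) (h1 : (1 : R) ∉ V)
    (hsup : ∀ a ∈ A, ∃ r : ℝ, a - r • (1 : R) ∈ V) (hV : ∀ v ∈ V, ∃ r : ℝ, v * v = r • (1 : R)) :
    ∃ (k : ℕ) (v : Fin k → R), IsSpinBasis A v := by
  have := hA.finiteDimensional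
  have : FiniteDimensional ℝ V := Submodule.finiteDimensional_of_le hVA
  have hsupA : Submodule.span ℝ {(1 : R)} ⊔ V = A := by
    apply le_antisymm
    · rw [sup_le_iff, Submodule.span_singleton_le_iff_mem]
      exact ⟨hA.one_mem, hVA⟩
    · intro a ha
      obtain ⟨r, hr⟩ := hsup a ha
      exact Submodule.mem_sup.2 ⟨r • 1, Submodule.smul_mem _ _ (Submodule.mem_span_singleton_self 1),
        _, hr, by abel⟩
  obtain ⟨v, hv, hspan⟩ := exists_cliffordSystem V fun v hv => by
    obtain ⟨r, hr⟩ := hV v hv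
    refine ⟨r, ?_, hr, ?_⟩
    · by_contra! hneg
      have := hA.eq_zero_of_sq_add_sq (A.smul_mem (√(-r)) hA.one_mem) (hVA hv) (by
        rw [smul_mul_smul_comm, Real.mul_self_sqrt (by linarith), hr, mul_one, ← add_smul,
          neg_add_cancel, zero_smul])
      rw [smul_eq_zero, or_iff_left one_ne_zero, Real.sqrt_eq_zero (by linarith)] at this
      linarith
    · rintro rfl
      exact hA.eq_zero_of_sq (hVA hv) (by rw [hr, zero_smul])
  refine ⟨_, v, hv, by rw [hspan, hsupA], ?_⟩
  rw [← hsupA, finrank_span_one_sup V h1]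

theorem IsFrame.exists_spinBasis {ι : Type*} [Fintype ι] {A : Submodule ℝ R} {e : ι → R}
    (he : IsFrame A e) (hA : IsFormallyReal A) [Nontrivial R]
    (h3 : ¬ ∀ i j : ι, ∃ k, k ≠ i ∧ k ≠ j) : ∃ (k : ℕ) (v : Fin k → R), IsSpinBasis A v := by
  classical
  push Not at h3
  obtain ⟨i, j, hij⟩ := h3
  have huniv : (Finset.univ : Finset ι) = {i, j} := by
    ext k
    by_cases h : k = i
    · simp [h]
    · simp [hij k h]
  rcases eq_or_ne i j with rfl | hne
  · have hone : e i = 1 := by simpa [huniv] using he.sum_eq_one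
    refine exists_spinBasis_of_submodule hA ⊥ bot_le (by simp) (fun a ha => ?_) (fun v hv => ?_)
    · obtain ⟨r, hr⟩ := he.minimal i a ha
      exact ⟨r, by simpa [hone, sub_eq_zero] using hr⟩
    · exact ⟨0, by simp [(Submodule.mem_bot ℝ).1 hv]⟩
  · have hone : e i + e j = 1 := by
      have := he.sum_eq_one
      rwa [huniv, Finset.sum_pair hne] at this
    have hdec : ∀ a, a = e i * a * e i + e j * a * e j + (e i * a * e j + e j * a * e i) := by
      intro a
      have : a = (e i + e j) * a * (e i + e j) := by rw [hone, one_mul, mul_one]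
      conv_lhs => rw [this]
      noncomm_ring
    -- The trace-zero elements: opposite coefficients on `e i` and `e j`. Their diagonal part
    -- anticommutes with their off-diagonal part, so their squares are scalar.
    let V : Submodule ℝ R :=
      { carrier := {a | a ∈ A ∧ ∃ r : ℝ, e i * a * e i = r • e i ∧ e j * a * e j = (-r) • e j}
        add_mem' := by
          rintro x y ⟨hx, r, hr1, hr2⟩ ⟨hy, s, hs1, hs2⟩
          refine ⟨A.add_mem hx hy, r + s, ?_, ?_⟩
          · rw [mul_add, add_mul, hr1, hs1, add_smul]
          · rw [mul_add, add_mul, hr2, hs2]; module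
        zero_mem' := ⟨A.zero_mem, 0, by simp, by simp⟩
        smul_mem' := by
          rintro c x ⟨hx, r, hr1, hr2⟩
          refine ⟨A.smul_mem c hx, c * r, ?_, ?_⟩
          · rw [mul_smul_comm, smul_mul_assoc, hr1, mul_smul]
          · rw [mul_smul_comm, smul_mul_assoc, hr2]; module }
    refine exists_spinBasis_of_submodule hA V (fun x hx => hx.1) ?_ (fun a ha => ?_) ?_
    · rintro ⟨-, r, hr1, hr2⟩
      rw [mul_one, he.mul_self] at hr1 hr2
      have k1 : (1 - r) • e i = 0 := by rw [sub_smul, one_smul, ← hr1, sub_self]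
      have k2 : (1 + r) • e j = 0 := by
        rw [add_smul, one_smul]; nth_rw 1 [hr2]; module
      have k3 := (smul_eq_zero.1 k1).resolve_right (he.ne_zero i)
      have k4 := (smul_eq_zero.1 k2).resolve_right (he.ne_zero j)
      linarith
    · obtain ⟨r, hr⟩ := he.minimal i a ha
      obtain ⟨s, hs⟩ := he.minimal j a ha
      refine ⟨(r + s) / 2, A.sub_mem ha (A.smul_mem _ hA.one_mem), (r - s) / 2, ?_, ?_⟩
      · rw [mul_sub, sub_mul, hr, mul_smul_comm, smul_mul_assoc, mul_one, he.mul_self]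
        module
      · rw [mul_sub, sub_mul, hs, mul_smul_comm, smul_mul_assoc, mul_one, he.mul_self]
        module
    · rintro v ⟨hv, r, hr1, hr2⟩
      obtain ⟨t, -, ht, -⟩ := he.peirce_mul_self hA hne (he.peirce_mem hA hv i j)
        (he.peirce_peirce hne v)
      refine ⟨r * r + t, ?_⟩
      set b := e i * v * e j + e j * v * e i with hb
      have hv' : v = r • (e i - e j) + b := by
        conv_lhs => rw [hdec v, hr1, hr2]
        module
      have h1 : (e i - e j) * (e i - e j) = 1 := by
        rw [mul_sub, sub_mul, sub_mul, he.mul_self, he.mul_self, he.mul_of_ne hne,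
          he.mul_of_ne hne.symm, ← hone]
        abel
      have h2 : (e i - e j) * b + b * (e i - e j) = 0 := by
        simp only [hb, mul_add, add_mul, mul_sub, sub_mul, mul_assoc, he.mul_self_mul,
          he.mul_self, he.mul_of_ne hne, he.mul_of_ne hne.symm, he.mul_mul_of_ne hne,
          he.mul_mul_of_ne hne.symm, mul_zero]
        abel
      rw [hone] at ht
      clear_value b
      rw [hv']
      calc (r • (e i - e j) + b) * (r • (e i - e j) + b)
          = (r * r) • ((e i - e j) * (e i - e j)) + r • ((e i - e j) * b + b * (e i - e j)) +
              b * b := by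
            rw [add_mul, mul_add, mul_add, smul_mul_smul_comm, smul_mul_assoc, mul_smul_comm,
              smul_add]
            abel
        _ = (r * r + t) • (1 : R) := by rw [h1, h2, ht, smul_zero, add_zero, ← add_smul]

end

end Encodings
-- Monomials and ideals in Clifford algebras.
namespace Encodings

namespace IsCliffordSystem

section

variable {R ι : Type*} [Ring R] [DecidableEq ι]

/-- The product of the `v i`, `i ∈ S`, in the order of the list `l`. -/
def monomial (v : ι → R) (l : List ι) (S : Finset ι) : R :=
  (l.map fun i => if i ∈ S then v i else 1).prod

theorem monomial_cons (v : ι → R) (i : ι) (l : List ι) (S : Finset ι) :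
    monomial v (i :: l) S = (if i ∈ S then v i else 1) * monomial v l S := by
  simp [monomial]

theorem monomial_empty (v : ι → R) (l : List ι) : monomial v l ∅ = 1 := by
  simp [monomial]

theorem monomial_congr (v : ι → R) {l : List ι} {S T : Finset ι}
    (h : ∀ i ∈ l, (i ∈ S ↔ i ∈ T)) : monomial v l S = monomial v l T := by
  rw [monomial, monomial]
  congr 1
  apply List.map_congr_left
  intro i hi
  simp only [h i hi]

variable {v : ι → R} (hv : IsCliffordSystem v)
include hv

/-- Moving `v i` to its own slot costs only signs; there it is inserted, or cancels by `v i * v i =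
1`. -/
theorem mul_monomial (l : List ι) (hl : l.Nodup) (i : ι) (hi : i ∈ l) (S : Finset ι) :
    v i * monomial v l S = monomial v l (symmDiff S {i}) ∨
      v i * monomial v l S = -monomial v l (symmDiff S {i}) := by
  induction l with
  | nil => simp at hi
  | cons j l ih =>
    rw [List.nodup_cons] at hl
    rw [monomial_cons, monomial_cons]
    rcases eq_or_ne i j with rfl | hij
    · left
      have h : monomial v l S = monomial v l (symmDiff S {i}) := by
        apply monomial_congr
        intro k hk
        have : k ≠ i := fun h => hl.1 (h ▸ hk)
        simp [Finset.mem_symmDiff, this]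
      rw [← h, ← mul_assoc]
      by_cases hiS : i ∈ S <;> simp [Finset.mem_symmDiff, hiS, hv.mul_self]
    · have hi' : i ∈ l := (List.mem_cons.1 hi).resolve_left hij
      have hjS : j ∈ symmDiff S {i} ↔ j ∈ S := by
        simp [Finset.mem_symmDiff, hij.symm]
      simp only [hjS]
      by_cases hj : j ∈ S
      · simp only [hj, if_true]
        rw [← mul_assoc, hv.mul_of_ne hij, neg_mul, mul_assoc]
        rcases ih hl.2 hi' with h | h <;> rw [h]
        · exact Or.inr rfl
        · left; rw [mul_neg, neg_neg]
      · simpa [hj] using ih hl.2 hi'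

theorem mul_monomial_comm (l : List ι) (hl : l.Nodup) (i : ι) (S : Finset ι) :
    v i * monomial v l S =
      (-1) ^ (l.toFinset ∩ (S.erase i)).card * (monomial v l S * v i) := by
  induction l with
  | nil => simp [monomial]
  | cons j l ih =>
    rw [List.nodup_cons] at hl
    have hjl : j ∉ l.toFinset := by simpa using hl.1
    rw [monomial_cons, List.toFinset_cons]
    by_cases hj : j ∈ S
    · simp only [hj, if_true]
      rcases eq_or_ne i j with rfl | hij
      · rw [Finset.insert_inter_of_notMem (by simp), mul_assoc, ih hl.2, ← mul_assoc,
          ← mul_assoc, ← ((Commute.neg_one_left (v i)).pow_left _).eq]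
        simp only [mul_assoc]
      · rw [Finset.insert_inter_of_mem (by simp [hj, hij.symm]),
          Finset.card_insert_of_notMem (fun h => hjl (Finset.mem_inter.1 h).1),
          ← mul_assoc, hv.mul_of_ne hij, neg_mul, mul_assoc, ih hl.2, pow_succ, ← mul_assoc (v j),
          ← ((Commute.neg_one_left (v j)).pow_left _).eq]
        simp only [mul_assoc, mul_neg, neg_mul, one_mul]
    · simp only [hj, if_false, one_mul]
      rw [Finset.insert_inter_of_notMem (by simp [hj]), ih hl.2]

end

section

variable {R : Type*} [Ring R] {k : ℕ} {v : Fin k → R}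

/-- The product of the `v i`, `i ∈ S`, in increasing order. -/
def mon (v : Fin k → R) (S : Finset (Fin k)) : R := monomial v (List.finRange k) S

theorem mon_empty (v : Fin k → R) : mon v ∅ = 1 := monomial_empty _ _

variable (hv : IsCliffordSystem v)
include hv

theorem mul_mon (i : Fin k) (S : Finset (Fin k)) :
    v i * mon v S = mon v (symmDiff S {i}) ∨ v i * mon v S = -mon v (symmDiff S {i}) :=
  hv.mul_monomial _ (List.nodup_finRange k) i (List.mem_finRange i) S

theorem mul_mon_comm (i : Fin k) (S : Finset (Fin k)) :
    v i * mon v S = (-1) ^ (S.erase i).card * (mon v S * v i) := by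
  have := hv.mul_monomial_comm (List.finRange k) (List.nodup_finRange k) i S
  rwa [show (List.finRange k).toFinset = Finset.univ by ext; simp, Finset.univ_inter] at this

theorem mul_mon_mul_of_even {i : Fin k} {S : Finset (Fin k)} (h : Even (S.erase i).card) :
    v i * mon v S * v i = mon v S := by
  rw [hv.mul_mon_comm, h.neg_one_pow, one_mul, mul_assoc, hv.mul_self, mul_one]

theorem mul_mon_mul_of_not_even {i : Fin k} {S : Finset (Fin k)} (h : ¬ Even (S.erase i).card) :
    v i * mon v S * v i = -mon v S := by
  rw [hv.mul_mon_comm, (Nat.not_even_iff_odd.1 h).neg_one_pow, neg_mul, one_mul, neg_mul,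
    mul_assoc, hv.mul_self, mul_one]

theorem span_mon_eq_top [Algebra ℝ R] (henv : Algebra.adjoin ℝ (Set.range v) = ⊤) :
    Submodule.span ℝ (Set.range (mon v)) = ⊤ := by
  have hmul : ∀ i, ∀ x ∈ Submodule.span ℝ (Set.range (mon v)),
      v i * x ∈ Submodule.span ℝ (Set.range (mon v)) := by
    intro i x hx
    induction hx using Submodule.span_induction with
    | mem x hx =>
      obtain ⟨S, rfl⟩ := hx
      have hm := Submodule.subset_span (R := ℝ) (Set.mem_range_self (f := mon v) (symmDiff S {i}))
      rcases hv.mul_mon i S with h | h <;> rw [h]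
      · exact hm
      · exact Submodule.neg_mem _ hm
    | zero => rw [mul_zero]; exact Submodule.zero_mem _
    | add x y _ _ hx hy => rw [mul_add]; exact Submodule.add_mem _ hx hy
    | smul r x _ hx => rw [mul_smul_comm]; exact Submodule.smul_mem _ _ hx
  have hmul' : ∀ y ∈ Algebra.adjoin ℝ (Set.range v),
      ∀ x ∈ Submodule.span ℝ (Set.range (mon v)),
        y * x ∈ Submodule.span ℝ (Set.range (mon v)) := by
    intro y hy
    induction hy using Algebra.adjoin_induction with
    | mem y hy => obtain ⟨i, rfl⟩ := hy; exact hmul i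
    | algebraMap r =>
      intro x hx
      rw [← Algebra.smul_def]
      exact Submodule.smul_mem _ _ hx
    | add y z _ _ hy hz =>
      intro x hx
      rw [add_mul]
      exact Submodule.add_mem _ (hy x hx) (hz x hx)
    | mul y z _ _ hy hz =>
      intro x hx
      rw [mul_assoc]
      exact hy _ (hz x hx)
  rw [eq_top_iff]
  rintro x -
  have := hmul' x (henv ▸ Algebra.mem_top) 1 (Submodule.subset_span ⟨∅, mon_empty v⟩)
  rwa [mul_one] at this

/-- Normalises an element so that the monomial 1 occurs, without increasing the number of monomials;
the left inverse `z` keeps it nonzero. -/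
theorem exists_mul_mon (S₀ : Finset (Fin k)) : ∃ y z : R, z * y = 1 ∧
    ∃ f : Finset (Fin k) → Finset (Fin k), f S₀ = ∅ ∧
      ∀ S, y * mon v S = mon v (f S) ∨ y * mon v S = -mon v (f S) := by
  induction S₀ using Finset.induction_on with
  | empty => exact ⟨1, 1, mul_one 1, id, rfl, fun S => Or.inl (one_mul _)⟩
  | insert i S₀ hi ih =>
    obtain ⟨y, z, hzy, f, hf0, hf⟩ := ih
    refine ⟨y * v i, v i * z, ?_, fun S => f (symmDiff S {i}), ?_, fun S => ?_⟩
    · rw [mul_assoc, ← mul_assoc z, hzy, one_mul, hv.mul_self]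
    · have hS : symmDiff (insert i S₀) {i} = S₀ := by
        ext j
        rcases eq_or_ne j i with rfl | hj
        · simp [Finset.mem_symmDiff, hi]
        · simp [Finset.mem_symmDiff, hj]
      simp only [hS, hf0]
    · rw [mul_assoc]
      rcases hv.mul_mon i S with h | h <;> rw [h]
      · exact hf _
      · rw [mul_neg]
        rcases hf (symmDiff S {i}) with h | h <;> rw [h]
        · exact Or.inr rfl
        · left; rw [neg_neg]

variable [Algebra ℝ R]

/-- Conjugation by `v i` multiplies each monomial by a sign, so adding the conjugate removes the
monomials of sign `-1`. -/
theorem add_conj_mem (i : Fin k) (t : Finset (Finset (Fin k))) {x : R}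
    (hx : x ∈ Submodule.span ℝ (mon v '' t)) :
    x + v i * x * v i ∈
      Submodule.span ℝ (mon v '' ({S ∈ t | Even (S.erase i).card} : Finset _)) := by
  induction hx using Submodule.span_induction with
  | mem x hx =>
    obtain ⟨S, hS, rfl⟩ := hx
    by_cases h : Even (S.erase i).card
    · rw [hv.mul_mon_mul_of_even h]
      have : mon v S ∈ Submodule.span ℝ
          (mon v '' ({S ∈ t | Even (S.erase i).card} : Finset _)) :=
        Submodule.subset_span ⟨S, by simpa [h] using hS, rfl⟩
      exact Submodule.add_mem _ this this
    · rw [hv.mul_mon_mul_of_not_even h, add_neg_cancel]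
      exact Submodule.zero_mem _
  | zero => simp
  | add x y _ _ hx hy =>
    convert Submodule.add_mem _ hx hy using 1
    noncomm_ring
  | smul r x _ hx =>
    convert Submodule.smul_mem _ r hx using 1
    rw [mul_smul_comm, smul_mul_assoc, smul_add]

theorem sub_conj_mem (i : Fin k) (t : Finset (Finset (Fin k))) {x : R}
    (hx : x ∈ Submodule.span ℝ (mon v '' t)) :
    x - v i * x * v i ∈
      Submodule.span ℝ (mon v '' ({S ∈ t | ¬ Even (S.erase i).card} : Finset _)) := by
  induction hx using Submodule.span_induction with
  | mem x hx =>
    obtain ⟨S, hS, rfl⟩ := hx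
    by_cases h : Even (S.erase i).card
    · rw [hv.mul_mon_mul_of_even h, sub_self]
      exact Submodule.zero_mem _
    · rw [hv.mul_mon_mul_of_not_even h, sub_neg_eq_add]
      have : mon v S ∈ Submodule.span ℝ
          (mon v '' ({S ∈ t | ¬ Even (S.erase i).card} : Finset _)) :=
        Submodule.subset_span ⟨S, Finset.mem_filter.2 ⟨hS, h⟩, rfl⟩
      exact Submodule.add_mem _ this this
  | zero => simp
  | add x y _ _ hx hy =>
    convert Submodule.add_mem _ hx hy using 1
    noncomm_ring
  | smul r x _ hx =>
    convert Submodule.smul_mem _ r hx using 1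
    rw [mul_smul_comm, smul_mul_assoc, smul_sub]

omit [Algebra ℝ R] hv in
-- Identifies the monomials fixed by conjugation with every generator: only 1, and the volume
-- element when `k` is odd.
theorem eq_empty_or_univ_of_even_card_erase {S : Finset (Fin k)}
    (h : ∀ i, Even (S.erase i).card) : S = ∅ ∨ (S = Finset.univ ∧ ¬ Even k) := by
  rcases S.eq_empty_or_nonempty with hS | ⟨i, hi⟩
  · exact Or.inl hS
  right
  have h1 := h i
  have h2 := Finset.card_erase_add_one hi
  have h3 : S = Finset.univ := by
    by_contra hne
    obtain ⟨j, hj⟩ : ∃ j, j ∉ S := by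
      by_contra! hall
      exact hne (Finset.eq_univ_iff_forall.2 hall)
    have h4 := h j
    rw [Finset.erase_eq_of_notMem hj] at h4
    rw [Nat.even_iff] at h1 h4
    omega
  refine ⟨h3, ?_⟩
  have h5 : S.card = k := by rw [h3]; simp
  rw [Nat.even_iff] at h1 ⊢
  omega

/-- Every nonzero ideal of a Clifford algebra meets the span of `1` and the volume element. -/
theorem exists_mem_span_one_mon (henv : Algebra.adjoin ℝ (Set.range v) = ⊤)
    (I : TwoSidedIdeal R) {x : R} (hxI : x ∈ I) (hx0 : x ≠ 0) :
    ∃ c d : ℝ, c • (1 : R) + d • mon v Finset.univ ∈ I ∧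
      c • (1 : R) + d • mon v Finset.univ ≠ 0 ∧ (Even k → d = 0) := by
  classical
  -- Take a nonzero element of the ideal supported on as few monomials as possible.
  have hex : ∃ n, ∃ s : Finset (Finset (Fin k)), s.card = n ∧
      ∃ x ∈ I, x ≠ 0 ∧ x ∈ Submodule.span ℝ (mon v '' s) :=
    ⟨_, Finset.univ, rfl, x, hxI, hx0, by
      rw [Finset.coe_univ, Set.image_univ, hv.span_mon_eq_top henv]; trivial⟩
  obtain ⟨s, hs, w, hwI, hw0, hw⟩ := Nat.find_spec hex
  have hmin : ∀ t : Finset (Finset (Fin k)), t.card < s.card → ∀ x ∈ I,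
      x ∈ Submodule.span ℝ (mon v '' t) → x = 0 := by
    intro t ht x hxI hx
    by_contra hx0
    rw [hs] at ht
    exact Nat.find_min hex ht ⟨t, rfl, x, hxI, hx0, hx⟩
  obtain ⟨S₀, hS₀⟩ : s.Nonempty := by
    rw [Finset.nonempty_iff_ne_empty]
    rintro rfl
    simp at hw
    exact hw0 hw
  obtain ⟨y, z, hzy, f, hf0, hf⟩ := hv.exists_mul_mon S₀
  set t := s.image f with ht
  have htcard : t.card ≤ s.card := Finset.card_image_le
  have h0t : ∅ ∈ t := Finset.mem_image.2 ⟨S₀, hS₀, hf0⟩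
  set u := y * w with hu
  have huI : u ∈ I := I.mul_mem_left _ _ hwI
  have hu0 : u ≠ 0 := by
    intro h
    apply hw0
    rw [← one_mul w, ← hzy, mul_assoc, ← hu, h, mul_zero]
  have hut : u ∈ Submodule.span ℝ (mon v '' t) := by
    rw [hu]
    clear_value u
    clear hu huI hu0 hw0 hwI
    induction hw using Submodule.span_induction with
    | mem x hx =>
      obtain ⟨S, hS, rfl⟩ := hx
      have : mon v (f S) ∈ Submodule.span ℝ (mon v '' t) :=
        Submodule.subset_span ⟨f S, Finset.mem_coe.2 (Finset.mem_image_of_mem f hS), rfl⟩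
      rcases hf S with h | h <;> rw [h]
      · exact this
      · exact Submodule.neg_mem _ this
    | zero => rw [mul_zero]; exact Submodule.zero_mem _
    | add a b _ _ ha hb => rw [mul_add]; exact Submodule.add_mem _ ha hb
    | smul r a _ ha => rw [mul_smul_comm]; exact Submodule.smul_mem _ _ ha
  -- If conjugation by `v i` negates the monomial of `S` while fixing 1, then both `u + v i * u * v
  -- i` and `u - v i * u * v i` have smaller support. By minimality both vanish, and so does `u`.
  have heven : ∀ S ∈ t, ∀ i, Even (S.erase i).card := by
    intro S hS i
    by_contra hodd
    have h1 : u + v i * u * v i = 0 := by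
      refine hmin _ (lt_of_lt_of_le (Finset.card_lt_card ?_) htcard) _
        (I.add_mem huI (I.mul_mem_right _ _ (I.mul_mem_left _ _ huI))) (hv.add_conj_mem i t hut)
      rw [Finset.filter_ssubset]
      exact ⟨S, hS, hodd⟩
    have h2 : u - v i * u * v i = 0 := by
      refine hmin _ (lt_of_lt_of_le (Finset.card_lt_card ?_) htcard) _
        (I.sub_mem huI (I.mul_mem_right _ _ (I.mul_mem_left _ _ huI))) (hv.sub_conj_mem i t hut)
      rw [Finset.filter_ssubset]
      exact ⟨∅, h0t, by simp⟩
    apply hu0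
    have h3 : (2 : ℝ) • u = (u + v i * u * v i) + (u - v i * u * v i) := by
      rw [two_smul]; abel
    rw [h1, h2, add_zero, smul_eq_zero] at h3
    exact h3.resolve_left two_ne_zero
  by_cases hk : Even k
  · have hsub : mon v '' t ⊆ {1} := by
      rintro _ ⟨S, hS, rfl⟩
      rcases eq_empty_or_univ_of_even_card_erase (heven S hS) with h | h
      · rw [h, mon_empty]; rfl
      · exact absurd hk h.2
    obtain ⟨c, hc⟩ := Submodule.mem_span_singleton.1 (Submodule.span_mono hsub hut)
    refine ⟨c, 0, ?_, ?_, fun _ => rfl⟩ <;> rwa [zero_smul, add_zero, hc]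
  · have hsub : mon v '' t ⊆ {1, mon v Finset.univ} := by
      rintro _ ⟨S, hS, rfl⟩
      rcases eq_empty_or_univ_of_even_card_erase (heven S hS) with h | h
      · rw [h, mon_empty]; exact Or.inl rfl
      · rw [h.1]; exact Or.inr rfl
    obtain ⟨c, d, hcd⟩ := Submodule.mem_span_pair.1 (Submodule.span_mono hsub hut)
    refine ⟨c, d, ?_, ?_, fun h => absurd h hk⟩ <;> rwa [hcd]

omit [Algebra ℝ R] in
theorem prod_mul_prod {l : List (Fin k)} (hl : l.Nodup) :
    (l.map v).prod * (l.map v).prod = (-1) ^ (l.length.choose 2) := by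
  have hcomm : ∀ (l : List (Fin k)) (i : Fin k), i ∉ l →
      (l.map v).prod * v i = (-1) ^ l.length * (v i * (l.map v).prod) := by
    intro l i hi
    induction l with
    | nil => simp
    | cons j l ih =>
      rw [List.mem_cons, not_or] at hi
      rw [List.map_cons, List.prod_cons, mul_assoc, ih hi.2, ← mul_assoc (v j),
        ← ((Commute.neg_one_left (v j)).pow_left _).eq, mul_assoc, ← mul_assoc (v j),
        hv.mul_of_ne (Ne.symm hi.1), List.length_cons, pow_succ]
      simp only [mul_assoc, neg_mul, one_mul, mul_neg]
  induction l with
  | nil => simp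
  | cons i l ih =>
    rw [List.nodup_cons] at hl
    rw [List.map_cons, List.prod_cons, mul_assoc, ← mul_assoc _ (v i), hcomm l i hl.1,
      mul_assoc ((-1) ^ _), mul_assoc (v i) (l.map v).prod, ih hl.2, ← mul_assoc (v i),
      ← ((Commute.neg_one_left (v i)).pow_left _).eq, mul_assoc, ← mul_assoc (v i),
      hv.mul_self, one_mul, ← pow_add, List.length_cons, Nat.choose_succ_succ', Nat.choose_one_right]

omit [Algebra ℝ R] in
theorem mon_univ_mul_self : mon v Finset.univ * mon v Finset.univ = (-1) ^ (k.choose 2) := by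
  have := hv.prod_mul_prod (List.nodup_finRange k)
  rw [List.length_finRange] at this
  simpa [mon, monomial] using this

end

end IsCliffordSystem

end Encodings
-- The dichotomy for enveloping algebras, and the exceptional case.
namespace Encodings

section

variable {R : Type*} [Ring R] [Algebra ℝ R]

theorem IsFormallyReal.one_mem_or_exists_spinBasis [Nontrivial R] {A : Submodule ℝ R}
    (hA : IsFormallyReal A) (hs : IsSimpleJordan A) (henv : Algebra.adjoin ℝ (A : Set R) = ⊤) :
    (∀ (I : TwoSidedIdeal R) (x : R), x ∈ I → x ≠ 0 → (1 : R) ∈ I) ∨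
      ∃ (k : ℕ) (v : Fin k → R), IsSpinBasis A v := by
  obtain ⟨s, he⟩ := hA.exists_frame
  by_cases h3 : ∀ i j : s, ∃ k, k ≠ i ∧ k ≠ j
  · left
    intro I x hxI hx0
    have hne : Nonempty s := by
      by_contra h
      rw [not_nonempty_iff] at h
      have := he.sum_eq_one
      rw [Fintype.sum_empty] at this
      exact zero_ne_one this
    obtain ⟨o⟩ := hne
    obtain ⟨F, G, hm⟩ := he.exists_matrixUnits hA hs o
    exact hm.one_mem_of_ne_zero he hA h3 henv I hxI hx0
  · exact Or.inr (he.exists_spinBasis hA h3)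

theorem isSimpleRing_of_one_mem {R : Type*} [Ring R] [Nontrivial R]
    (h : ∀ (I : TwoSidedIdeal R) (x : R), x ∈ I → x ≠ 0 → (1 : R) ∈ I) : IsSimpleRing R := by
  apply IsSimpleRing.of_eq_bot_or_eq_top
  intro I
  rw [or_iff_not_imp_left]
  intro hI
  obtain ⟨x, hxI, hx0⟩ : ∃ x ∈ I, x ≠ 0 := by
    by_contra! h0
    apply hI
    ext x
    rw [TwoSidedIdeal.mem_bot]
    exact ⟨h0 x, fun hx => hx ▸ I.zero_mem⟩
  exact (TwoSidedIdeal.one_mem_iff I).1 (h I x hxI hx0)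

theorem IsSpinBasis.isSpinFactor [Nontrivial R] {k : ℕ} {A : Submodule ℝ R} {v : Fin k → R}
    (hv : IsSpinBasis A v) : IsSpinFactor A := by
  obtain ⟨hc, hsup, hrank⟩ := hv
  refine ⟨Submodule.span ℝ (Set.range v), ?_, hsup, ?_⟩
  · have : FiniteDimensional ℝ (Submodule.span ℝ (Set.range v)) :=
      FiniteDimensional.span_of_finite ℝ (Set.finite_range v)
    -- The sum has dimension `k + 1` while the summands have dimension 1 and at most `k`, so they
    -- meet trivially.
    have h1 := Submodule.finrank_sup_add_finrank_inf_eq (Submodule.span ℝ {(1 : R)})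
      (Submodule.span ℝ (Set.range v))
    have h2 : Module.finrank ℝ (Submodule.span ℝ (Set.range v)) ≤ k := by
      exact (finrank_range_le_card (R := ℝ) v).trans_eq (Fintype.card_fin k)
    rw [hsup, hrank, finrank_span_singleton one_ne_zero] at h1
    have h3 : Module.finrank ℝ
        (Submodule.span ℝ {(1 : R)} ⊓ Submodule.span ℝ (Set.range v) : Submodule ℝ R) = 0 := by
      omega
    rw [disjoint_iff]
    exact Submodule.finrank_eq_zero.1 h3
  · intro x hx y hy
    induction hx, hy using Submodule.span_induction₂ with
    | mem_mem x y hx hy =>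
      obtain ⟨i, rfl⟩ := hx
      obtain ⟨j, rfl⟩ := hy
      rcases eq_or_ne i j with rfl | hij
      · exact ⟨1, by rw [jordanProd_self, hc.mul_self, one_smul]⟩
      · exact ⟨0, by rw [jordanProd, hc.mul_of_ne hij, neg_add_cancel, smul_zero, zero_smul]⟩
    | zero_left y hy => exact ⟨0, by simp [jordanProd]⟩
    | zero_right x hx => exact ⟨0, by simp [jordanProd]⟩
    | add_left x y z _ _ _ hx hy =>
      obtain ⟨r, hr⟩ := hx
      obtain ⟨s, hs⟩ := hy
      refine ⟨r + s, ?_⟩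
      rw [add_smul, ← hr, ← hs, jordanProd, jordanProd, jordanProd, ← smul_add]
      noncomm_ring
    | add_right x y z _ _ _ hx hy =>
      obtain ⟨r, hr⟩ := hx
      obtain ⟨s, hs⟩ := hy
      refine ⟨r + s, ?_⟩
      rw [add_smul, ← hr, ← hs, jordanProd, jordanProd, jordanProd, ← smul_add]
      noncomm_ring
    | smul_left c x y _ _ h =>
      obtain ⟨r, hr⟩ := h
      refine ⟨c * r, ?_⟩
      rw [mul_smul, ← hr, jordanProd, jordanProd, smul_mul_assoc, mul_smul_comm, ← smul_add,
        smul_comm]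
    | smul_right c x y _ _ h =>
      obtain ⟨r, hr⟩ := h
      refine ⟨c * r, ?_⟩
      rw [mul_smul, ← hr, jordanProd, jordanProd, smul_mul_assoc, mul_smul_comm, ← smul_add,
        smul_comm]

/-- A relation with `d ≠ 0` makes `ω` a scalar and `k` odd. If `k ≡ 1 mod 4`, every nonzero ideal
then contains a nonzero scalar, so the ring is simple, which is excluded; if `k ≡ 3 mod 4`, a real
scalar would have square `-1`. -/
theorem IsCliffordSystem.linearIndependent_one_mon [Nontrivial R] {k : ℕ} {v : Fin k → R}
    (hv : IsCliffordSystem v) (henv : Algebra.adjoin ℝ (Set.range v) = ⊤)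
    (hexc : ¬ (k % 4 = 1 ∧ IsSimpleRing R)) {c d : ℝ}
    (h : c • (1 : R) + d • mon v Finset.univ = 0) (hd : Even k → d = 0) : c = 0 ∧ d = 0 := by
  set w := mon v Finset.univ with hw
  by_cases hd0 : d = 0
  · rw [hd0, zero_smul, add_zero] at h
    exact ⟨(smul_eq_zero.1 h).resolve_right one_ne_zero, hd0⟩
  exfalso
  have hw2 := hv.mon_univ_mul_self
  rw [← hw] at hw2
  have hwc : w = (-(d⁻¹ * c)) • (1 : R) := by
    have : d⁻¹ • (c • (1 : R) + d • w) = 0 := by rw [h, smul_zero]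
    rw [smul_add, inv_smul_smul₀ hd0, smul_smul] at this
    rw [neg_smul, eq_neg_iff_add_eq_zero, add_comm, this]
  have hodd : ¬ Even k := fun hk => hd0 (hd hk)
  rw [Nat.even_iff] at hodd
  have h4 : k % 4 = 1 ∨ k % 4 = 3 := by omega
  rcases h4 with h4 | h4
  · refine hexc ⟨h4, isSimpleRing_of_one_mem fun I x hxI hx0 => ?_⟩
    obtain ⟨a, b, hI, hne, -⟩ := hv.exists_mem_span_one_mon henv I hxI hx0
    rw [← hw, hwc, smul_smul, ← add_smul] at hI hne
    have := I.real_smul_mem (a + b * -(d⁻¹ * c))⁻¹ hI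
    rwa [inv_smul_smul₀ (fun h => hne (by rw [h, zero_smul]))] at this
  · have hk : Odd (k.choose 2) := by
      obtain ⟨m, rfl⟩ : ∃ m, k = 4 * m + 3 := ⟨k / 4, by omega⟩
      have : (4 * m + 3).choose 2 = (4 * m + 3) * (2 * m + 1) := by
        rw [Nat.choose_two_right, show 4 * m + 3 - 1 = 2 * (2 * m + 1) by omega,
          mul_left_comm, Nat.mul_div_cancel_left _ two_pos]
      rw [this]
      exact Odd.mul ⟨2 * m + 1, by ring⟩ ⟨m, rfl⟩
    rw [hk.neg_one_pow, hwc, smul_mul_smul_comm, mul_one] at hw2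
    have h1 : (-(d⁻¹ * c) * -(d⁻¹ * c) + 1) • (1 : R) = 0 := by
      rw [add_smul, hw2, one_smul, neg_add_cancel]
    have h2 := (smul_eq_zero.1 h1).resolve_right one_ne_zero
    nlinarith [mul_self_nonneg (d⁻¹ * c)]

end

/-! ### Extension of Jordan homomorphisms through the graph algebra. -/

section

variable {R C : Type*} [Ring R] [Algebra ℝ R] [Ring C] [Algebra ℝ C] {A : Submodule ℝ R}

theorem IsFormallyReal.range (hA : IsFormallyReal A) (f : A →ₗ[ℝ] C) (π : C →ₐ[ℝ] R)
    (hπ : ∀ a, π (f a) = a) (h1 : f ⟨1, hA.one_mem⟩ = 1)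
    (hmul : ∀ a b : A, f ⟨a * b + b * a, hA.mul_add_mul_mem a.2 b.2⟩ = f a * f b + f b * f a) :
    IsFormallyReal f.range where
  one_mem := ⟨_, h1⟩
  mul_add_mul_mem := by
    rintro _ _ ⟨a, rfl⟩ ⟨b, rfl⟩
    exact ⟨_, hmul a b⟩
  finiteDimensional := by
    have := hA.finiteDimensional
    infer_instance
  eq_zero_of_sq_add_sq := by
    rintro _ _ ⟨a, rfl⟩ ⟨b, rfl⟩ h
    have h' : (a : R) * a + b * b = 0 := by
      simpa [hπ] using congrArg π h
    have : a = 0 := Subtype.ext (hA.eq_zero_of_sq_add_sq a.2 b.2 h')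
    rw [this, map_zero]

theorem IsSimpleJordan.range (hs : IsSimpleJordan A) (f : A →ₗ[ℝ] C) (π : C →ₐ[ℝ] R)
    (hπ : ∀ a, π (f a) = a) : IsSimpleJordan f.range := by
  refine ⟨fun h => hs.1 ?_, fun I hI hmul => ?_⟩
  · rw [LinearMap.range_eq_bot] at h
    rw [eq_bot_iff]
    intro a ha
    have := hπ ⟨a, ha⟩
    rw [h, LinearMap.zero_apply, map_zero] at this
    exact this.symm
  · have hJ := hs.2 (I.map π.toLinearMap) (by
      rintro _ ⟨x, hx, rfl⟩
      obtain ⟨a, rfl⟩ := hI hx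
      rw [AlgHom.toLinearMap_apply, hπ]
      exact a.2) (by
      rintro a ha _ ⟨x, hx, rfl⟩
      refine ⟨_, hmul (f ⟨a, ha⟩) ⟨_, rfl⟩ x hx, ?_⟩
      simp [jordanProd, hπ])
    rcases hJ with hJ | hJ
    · left
      rw [eq_bot_iff]
      intro x hx
      obtain ⟨a, rfl⟩ := hI hx
      have : π (f a) ∈ I.map π.toLinearMap := ⟨_, hx, rfl⟩
      rw [hJ, hπ, Submodule.mem_bot] at this
      rw [show a = 0 from Subtype.ext this, map_zero]
      exact Submodule.zero_mem _
    · right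
      refine le_antisymm hI ?_
      rintro _ ⟨a, rfl⟩
      obtain ⟨x, hx, hxa⟩ : (a : R) ∈ I.map π.toLinearMap := hJ ▸ a.2
      obtain ⟨b, rfl⟩ := hI hx
      rw [AlgHom.toLinearMap_apply, hπ] at hxa
      rwa [← Subtype.ext hxa]

theorem IsCliffordSystem.map {ι : Type*} {v : ι → C} (hv : IsCliffordSystem v)
    (π : C →ₐ[ℝ] R) : IsCliffordSystem (fun i => π (v i)) where
  mul_self i := by rw [← map_mul, hv.mul_self, map_one]
  mul_of_ne hij := by rw [← map_mul, hv.mul_of_ne hij, map_neg, map_mul]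

theorem map_mon {k : ℕ} (π : C →ₐ[ℝ] R) (v : Fin k → C) (S : Finset (Fin k)) :
    π (IsCliffordSystem.mon v S) = IsCliffordSystem.mon (fun i => π (v i)) S := by
  rw [IsCliffordSystem.mon, IsCliffordSystem.mon, IsCliffordSystem.monomial,
    IsCliffordSystem.monomial, map_list_prod, List.map_map]
  congr 1
  apply List.map_congr_left
  intro i _
  by_cases h : i ∈ S <;> simp [h]

theorem IsSpinBasis.adjoin_eq_top {k : ℕ} {v : Fin k → R} (hv : IsSpinBasis A v)
    (henv : Algebra.adjoin ℝ (A : Set R) = ⊤) : Algebra.adjoin ℝ (Set.range v) = ⊤ := by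
  rw [eq_top_iff, ← henv]
  apply Algebra.adjoin_le
  have : A ≤ Subalgebra.toSubmodule (Algebra.adjoin ℝ (Set.range v)) := by
    rw [← hv.2.1, sup_le_iff, Submodule.span_le, Submodule.span_le]
    exact ⟨Set.singleton_subset_iff.2 (one_mem (Algebra.adjoin ℝ (Set.range v))), Algebra.subset_adjoin⟩
  exact this

/-- A homomorphism of enveloping algebras of a simple Jordan algebra that restricts to an
isomorphism of the Jordan algebra is injective, outside the exceptional case. -/
theorem injective_of_enveloping [Nontrivial R] (hA : IsFormallyReal A) (hs : IsSimpleJordan A)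
    (henv : Algebra.adjoin ℝ (A : Set R) = ⊤)
    (hexc : ¬ (IsSpinFactor A ∧ Module.finrank ℝ A % 4 = 2 ∧ IsSimpleRing R))
    (f : A →ₗ[ℝ] C) (π : C →ₐ[ℝ] R) (hπ : ∀ a, π (f a) = a) (h1 : f ⟨1, hA.one_mem⟩ = 1)
    (hmul : ∀ a b : A, f ⟨a * b + b * a, hA.mul_add_mul_mem a.2 b.2⟩ = f a * f b + f b * f a)
    (henvC : Algebra.adjoin ℝ (f.range : Set C) = ⊤) : Function.Injective π := by
  have : Nontrivial C := π.toRingHom.domain_nontrivial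
  rw [injective_iff_map_eq_zero]
  intro x hx
  by_contra hx0
  set I := TwoSidedIdeal.ker π with hI
  have hxI : x ∈ I := (TwoSidedIdeal.mem_ker _).2 hx
  rcases (hA.range f π hπ h1 hmul).one_mem_or_exists_spinBasis (hs.range f π hπ) henvC with
    h | ⟨k, v, hv⟩
  · have := (TwoSidedIdeal.mem_ker _).1 (h I x hxI hx0)
    rw [map_one] at this
    exact one_ne_zero this
  · obtain ⟨c, d, hcd, hne, hd⟩ :=
      hv.1.exists_mem_span_one_mon (hv.adjoin_eq_top henvC) I hxI hx0
    have hfinj : Function.Injective f := fun a b hab => Subtype.ext (by rw [← hπ, hab, hπ])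
    have hmap : f.range.map π.toLinearMap = A := by
      ext a
      constructor
      · rintro ⟨_, ⟨a, rfl⟩, rfl⟩
        rw [AlgHom.toLinearMap_apply, hπ]
        exact a.2
      · intro ha
        exact ⟨f ⟨a, ha⟩, ⟨_, rfl⟩, hπ _⟩
    have hw : IsSpinBasis A (fun i => π (v i)) := by
      refine ⟨hv.1.map π, ?_, ?_⟩
      · rw [← hmap, ← hv.2.1, Submodule.map_sup, Submodule.map_span, Submodule.map_span,
          Set.image_singleton, ← Set.range_comp, AlgHom.toLinearMap_apply, map_one]
        rfl
      · rw [← hv.2.2, LinearMap.finrank_range_of_inj hfinj]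
    -- Applying `π` gives the same combination of 1 and the volume element of the image Clifford
    -- system in `R`, where the two are independent.
    have h0 := (TwoSidedIdeal.mem_ker _).1 hcd
    rw [map_add, map_smul, map_smul, map_one, map_mon] at h0
    obtain ⟨rfl, rfl⟩ := hw.1.linearIndependent_one_mon (hw.adjoin_eq_top henv)
      (fun h => hexc ⟨hw.isSpinFactor, by rw [hw.2.2]; omega, h.2⟩) h0 hd
    simp at hne

/-- Jordan homomorphisms extend to the enveloping algebra, outside the exceptional case. -/
theorem exists_algHom_extending [Nontrivial R] (hA : IsFormallyReal A) (hs : IsSimpleJordan A)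
    (henv : Algebra.adjoin ℝ (A : Set R) = ⊤)
    (hexc : ¬ (IsSpinFactor A ∧ Module.finrank ℝ A % 4 = 2 ∧ IsSimpleRing R))
    (f : A →ₗ[ℝ] C) (h1 : f ⟨1, hA.one_mem⟩ = 1)
    (hmul : ∀ a b : A, f ⟨a * b + b * a, hA.mul_add_mul_mem a.2 b.2⟩ = f a * f b + f b * f a) :
    ∃ Γ : R →ₐ[ℝ] C, ∀ a : A, Γ a = f a := by
  -- `D` is generated by the graph of `f`; once its projection `π` to `R` is bijective, `D` is
  -- itself the graph of the required homomorphism.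
  let g : A →ₗ[ℝ] R × C := A.subtype.prod f
  let D : Subalgebra ℝ (R × C) := Algebra.adjoin ℝ (Set.range g)
  let i : A →ₗ[ℝ] D :=
    g.codRestrict (Subalgebra.toSubmodule D) fun a => Algebra.subset_adjoin ⟨a, rfl⟩
  let π : D →ₐ[ℝ] R := (AlgHom.fst ℝ R C).comp D.val
  let ρ : D →ₐ[ℝ] C := (AlgHom.snd ℝ R C).comp D.val
  have hπ : ∀ a, π (i a) = a := fun a => rfl
  have hρ : ∀ a, ρ (i a) = f a := fun a => rfl
  have hext : ∀ x y : D, π x = π y → ρ x = ρ y → x = y := fun x y h h' =>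
    Subtype.ext (Prod.ext h h')
  have henvD : Algebra.adjoin ℝ (i.range : Set D) = ⊤ := by
    have hr : (i.range : Set D) = (Subtype.val : D → R × C) ⁻¹' Set.range g := by
      ext x
      constructor
      · rintro ⟨a, rfl⟩; exact ⟨a, rfl⟩
      · rintro ⟨a, ha⟩; exact ⟨a, Subtype.ext ha⟩
    rw [hr]
    exact Algebra.adjoin_adjoin_coe_preimage
  have hinj : Function.Injective π := injective_of_enveloping hA hs henv hexc i π hπ
    (hext _ _ (by rw [hπ, map_one]) (by rw [hρ, h1, map_one]))
    (fun a b => hext _ _ (by simp only [map_add, map_mul, hπ])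
      (by simp only [map_add, map_mul, hρ, hmul])) henvD
  have hsurj : Function.Surjective π := by
    rw [← AlgHom.range_eq_top, eq_top_iff, ← henv]
    apply Algebra.adjoin_le
    intro a ha
    exact ⟨i ⟨a, ha⟩, rfl⟩
  let E := AlgEquiv.ofBijective π ⟨hinj, hsurj⟩
  refine ⟨ρ.comp E.symm.toAlgHom, fun a => ?_⟩
  have : E.symm a = i a := by rw [AlgEquiv.symm_apply_eq]; rfl
  change ρ (E.symm a) = f a
  rw [this, hρ]

end

end Encodings

theorem mainTheorem4
    {𝒜 : Type*} [Ring 𝒜] [StarRing 𝒜] [Algebra ℝ 𝒜] [StarModule ℝ 𝒜]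
    {ℬ : Type*} [Ring ℬ] [StarRing ℬ] [Algebra ℝ ℬ] [StarModule ℝ ℬ]
    (A : Submodule ℝ 𝒜) (B : Submodule ℝ ℬ)
    (hA : Encodings.IsSpecialJB A) (hB : Encodings.IsSpecialJB B)
    (hsimple : Encodings.IsSimpleJordan A)
    (henv : Algebra.adjoin ℝ (A : Set 𝒜) = ⊤)
    (γ : A → B) (hγ : Encodings.IsEncoding γ) :
    -- the encoding is real-linear
    IsLinearMap ℝ γ ∧
    -- an extension to the enveloping algebra is uniquely determined by the encoding
    (∀ Γ Γ' : 𝒜 → ℬ, Encodings.IsExtendedEncoding γ Γ → Encodings.IsExtendedEncoding γ Γ' →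
      Γ = Γ') ∧
    -- it is additive, multiplicative, unital, real-homogeneous and preserves the involution
    (∀ Γ : 𝒜 → ℬ, Encodings.IsExtendedEncoding γ Γ →
      (∀ α₁ α₂ : 𝒜, Γ (α₁ + α₂) = Γ α₁ + Γ α₂) ∧
      (∀ α₁ α₂ : 𝒜, Γ (α₁ * α₂) = Γ α₁ * Γ α₂) ∧
      Γ 1 = 1 ∧
      (∀ (r : ℝ) (α : 𝒜), Γ (r • α) = r • Γ α) ∧
      (∀ α : 𝒜, Γ (star α) = star (Γ α))) ∧
    -- it exists, unless `A` is a spin factor of dimension `4m + 2` and `𝒜` is a simple ring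
    (¬ (Encodings.IsSpinFactor A ∧ Module.finrank ℝ A % 4 = 2 ∧ IsSimpleRing 𝒜) →
      ∃ Γ : 𝒜 → ℬ, Encodings.IsExtendedEncoding γ Γ) := by
  have : Nontrivial 𝒜 := by
    by_contra h
    rw [not_nontrivial_iff_subsingleton] at h
    exact hsimple.1 (Subsingleton.elim _ _)
  have hA' := hA.isFormallyReal
  have hB' := hB.isFormallyReal
  have hlin := hγ.isLinearMap hB'
  have h1 := hγ.map_one hA' hB'
  refine ⟨hlin, fun Γ Γ' h h' => h.ext_of_adjoin_eq_top hA'.one_mem h1 hlin henv h',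
    fun Γ h => ⟨h.map_add, h.map_mul, h.map_one hA'.one_mem h1, h.map_smul hA'.one_mem h1 hlin,
      h.map_star hA'.one_mem h1 hlin henv hA.star_eq hB.star_eq⟩, fun hexc => ?_⟩
  let f : A →ₗ[ℝ] ℬ := B.subtype ∘ₗ hlin.mk' γ
  obtain ⟨Γ, hΓ⟩ := Encodings.exists_algHom_extending hA' hsimple henv hexc f h1
    (Encodings.map_mul_add_mul_of_map_sq hA' f
      (Encodings.map_sq_of_spectrum_eq hA' hB' f (fun a => (γ a).2) hγ.spectrum_eq))
  exact ⟨Γ, hΓ, map_add Γ, map_mul Γ⟩
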